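/- **Setting.** Let $n\ge 1$ and $\mathbb R^n_+=\{x=(x',x_n)\in\mathbb R^n: x_n>0\}$. For a measurable function $p$ on $\mathbb R^n$ put $p^-=\operatorname{ess\,inf}_{\mathbb R^n}p$ and $p^+=\operatorname{ess\,sup}_{\mathbb R^n}p$. Let $\mathcal P_0(\mathbb R^n)$ be the set of measurable $p:\mathbb R^n\to(0,\infty)$ with $0<p^-$ and $p^+<\infty$. Let $C^{\log}(\mathbb R^n)$ be the set of $p:\mathbb R^n\to\mathbb R$ for which there are $C>0$ and $p_\infty\in\mathbb R$ with $$|p(x)-p(y)|\le \frac{C}{\log(e+|x-y|^{-1})}\quad(x\ne y),\qquad |p(x)-p_\infty|\le\frac{C}{\log(e+|x|)}\quad(x\in\mathbb R^n).$$ For $p,q\in\mathcal P_0(\mathbb R^n)$, a measurable $f:\mathbb R^n\to[0,\infty]$ or $f:\mathbb R^n\to\mathbb C$, and a sequence $(f_j)_{j\ge0}$ of measurable functions $\mathbb R^n\to\mathbb C$, put (with $\inf\emptyset=\infty$) $$\|f\|_{L^{p(\cdot)}}=\inf\Big\{\mu>0:\int_{\mathbb R^n}\Big(\frac{|f(x)|}{\mu}\Big)^{p(x)}dx\le1\Big\},\qquad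 \|(f_j)\|_{L^{p(\cdot)}(\ell^{q(\cdot)})}=\Big\|\Big(\sum_{j\ge0}|f_j(\cdot)|^{q(\cdot)}\Big)^{1/q(\cdot)}\Big\|_{L^{p(\cdot)}},$$ $$\|(f_j)\|_{\ell^{q(\cdot)}(L^{p(\cdot)})}=\inf\Big\{\mu>0:\ \sum_{j\ge0}\inf\Big\{\lambda>0:\int_{\mathbb R^n}\Big(\frac{|f_j(x)|/\mu}{\lambda^{1/q(x)}}\Big)^{p(x)}dx\le1\Big\}\le1\Big\}.$$ Let $\Phi(\mathbb R^n)$ be the set of sequences $\theta=(\theta_j)_{j\ge0}$ in $\mathcal S(\mathbb R^n)$ with $\operatorname{supp}\theta_0\subset\{|x|\le2\}$, $\operatorname{supp}\theta_j\subset\{2^{j-1}\le|x|\le2^{j+1}\}$ for $j\ge1$, $\sup_{j,x}2^{j|\beta|}|D^\beta\theta_j(x)|<\infty$ for every multi-index $\beta$, and $\sum_j\theta_j(x)=1$ for all $x$. Write $\theta_j(D)f=\mathcal F^{-1}[\theta_j\,\mathcal Ff]$ for $f\in\mathcal S'(\mathbb R^n)$, where $\mathcal F$ is the Fourier transform with kernel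 $e^{-ix\cdot\xi}$; this distribution is a function. Let $p,q\in C^{\log}(\mathbb R^n)\cap\mathcal P_0(\mathbb R^n)$, $s\in C^{\log}(\mathbb R^n)$ and $\theta\in\Phi(\mathbb R^n)$. For $f\in\mathcal S'(\mathbb R^n)$ put $$\|f\|_{B^{s(\cdot)}_{p(\cdot),q(\cdot)}}=\big\|(2^{js(\cdot)}\theta_j(D)f)_j\big\|_{\ell^{q(\cdot)}(L^{p(\cdot)})},\qquad \|f\|_{F^{s(\cdot)}_{p(\cdot),q(\cdot)}}=\big\|(2^{js(\cdot)}\theta_j(D)f)_j\big\|_{L^{p(\cdot)}(\ell^{q(\cdot)})},$$ and for $A\in\{B,F\}$ let $A^{s(\cdot)}_{p(\cdot),q(\cdot)}(\mathbb R^n)$ be the set of $f\in\mathcal S'(\mathbb R^n)$ with $\|f\|_{A^{s(\cdot)}_{p(\cdot),q(\cdot)}}<\infty$. Let $A^{s(\cdot)}_{p(\cdot),q(\cdot)}(\mathbb R^n_+)$ be the set of restrictions $g|_{\mathbb R^n_+}\in\mathcal D'(\mathbb R^n_+)$ of all $g\in A^{s(\cdot)}_{p(\cdot),q(\cdot)}(\mathbb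 R^n)$, with $$\|f\|_{A^{s(\cdot)}_{p(\cdot),q(\cdot)}(\mathbb R^n_+)}=\inf\big\{\|g\|_{A^{s(\cdot)}_{p(\cdot),q(\cdot)}}:\ g\in A^{s(\cdot)}_{p(\cdot),q(\cdot)}(\mathbb R^n),\ f=g|_{\mathbb R^n_+}\big\}.$$ **Theorem.** For all such $n,p,q,s,\theta$: 1. For $A=B$ and for $A=F$, $A^{s(\cdot)}_{p(\cdot),q(\cdot)}(\mathbb R^n_+)$ is a quasi-Banach space, that is, a complex vector space on which $\|\cdot\|_{A^{s(\cdot)}_{p(\cdot),q(\cdot)}(\mathbb R^n_+)}$ is a quasi-norm and in which every Cauchy sequence for this quasi-norm converges. 2. With $r=\min(p^-,q^-,1)$, for all $f,g\in F^{s(\cdot)}_{p(\cdot),q(\cdot)}(\mathbb R^n_+)$, $$\|f+g\|^{r}_{F^{s(\cdot)}_{p(\cdot),q(\cdot)}(\mathbb R^n_+)}\le\|f\|^{r}_{F^{s(\cdot)}_{p(\cdot),q(\cdot)}(\mathbb R^n_+)}+\|g\|^{r}_{F^{s(\cdot)}_{p(\cdot),q(\cdot)}(\mathbb R^n_+)}.$$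 3. With $\alpha=\min(q^-,1)\cdot\min\big(1,(p/q)^-\big)$, for all $f,g\in B^{s(\cdot)}_{p(\cdot),q(\cdot)}(\mathbb R^n_+)$, $$\|f+g\|^{\alpha}_{B^{s(\cdot)}_{p(\cdot),q(\cdot)}(\mathbb R^n_+)}\le\|f\|^{\alpha}_{B^{s(\cdot)}_{p(\cdot),q(\cdot)}(\mathbb R^n_+)}+\|g\|^{\alpha}_{B^{s(\cdot)}_{p(\cdot),q(\cdot)}(\mathbb R^n_+)}.$$ -/

import Mathlib

open MeasureTheory Filter Topology Set
open scoped ENNReal SchwartzMap Distributions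

noncomputable section

namespace VarExp

/-- Euclidean space `ℝⁿ`. -/
abbrev Eucl (n : ℕ) : Type := EuclideanSpace ℝ (Fin n)

/-! ### Variable exponents -/

/-- The class `𝒫₀(ℝⁿ)`: measurable `p : ℝⁿ → (0, ∞)` with `0 < ess inf p` and `ess sup p < ∞`. -/
structure IsExponent {n : ℕ} (p : Eucl n → ℝ) : Prop where
  measurable : Measurable p
  pos : ∀ x, 0 < p x
  essInf_pos : ∃ a : ℝ, 0 < a ∧ ∀ᵐ x ∂(volume : Measure (Eucl n)), a ≤ p x
  essSup_lt_top : ∃ b : ℝ, ∀ᵐ x ∂(volume : Measure (Eucl n)), p x ≤ b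

/-- The class `C^log(ℝⁿ)`: local log-Hölder continuity together with log-Hölder decay. -/
structure IsLogHolder {n : ℕ} (p : Eucl n → ℝ) : Prop where
  holder : ∃ C : ℝ, 0 < C ∧ ∀ x y : Eucl n, x ≠ y →
    |p x - p y| ≤ C / Real.log (Real.exp 1 + ‖x - y‖⁻¹)
  decay : ∃ C pInf : ℝ, 0 < C ∧ ∀ x : Eucl n,
    |p x - pInf| ≤ C / Real.log (Real.exp 1 + ‖x‖)

/-- `p⁻ = ess inf p` with respect to Lebesgue measure. -/
def lowerExp {n : ℕ} (p : Eucl n → ℝ) : ℝ := essInf p (volume : Measure (Eucl n))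

/-! ### Variable exponent (sequence) spaces

All (quasi-)norms take values in `[0, ∞]`; an object belongs to the corresponding space iff its
norm is finite. -/

/-- The Luxemburg–Nakano norm of `L^{p(·)}(ℝⁿ)`, for the modulus `F = |f| : ℝⁿ → [0, ∞]`. -/
def luxNorm {n : ℕ} (p : Eucl n → ℝ) (F : Eucl n → ℝ≥0∞) : ℝ≥0∞ :=
  sInf {μ : ℝ≥0∞ | 0 < μ ∧ μ ≠ ∞ ∧ ∫⁻ x, (F x / μ) ^ p x ≤ 1}

/-- The norm of `L^{p(·)}(ℓ^{q(·)})`. -/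
def normLpLq {n : ℕ} (p q : Eucl n → ℝ) (g : ℕ → Eucl n → ℂ) : ℝ≥0∞ :=
  luxNorm p fun x => (∑' j, ‖g j x‖ₑ ^ q x) ^ (1 / q x)

/-- The modular of `ℓ^{q(·)}(L^{p(·)})`, for the moduli `F j = |f j| : ℝⁿ → [0, ∞]`. -/
def modularLqLp {n : ℕ} (p q : Eucl n → ℝ) (F : ℕ → Eucl n → ℝ≥0∞) : ℝ≥0∞ :=
  ∑' j, sInf {l : ℝ≥0∞ | 0 < l ∧ l ≠ ∞ ∧ ∫⁻ x, (F j x / l ^ (1 / q x)) ^ p x ≤ 1}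

/-- The norm of `ℓ^{q(·)}(L^{p(·)})`. -/
def normLqLp {n : ℕ} (p q : Eucl n → ℝ) (g : ℕ → Eucl n → ℂ) : ℝ≥0∞ :=
  sInf {μ : ℝ≥0∞ | 0 < μ ∧ μ ≠ ∞ ∧ modularLqLp p q (fun j x => ‖g j x‖ₑ / μ) ≤ 1}

/-! ### Resolutions of unity and Fourier multipliers -/

/-- The class `Φ(ℝⁿ)` of smooth dyadic resolutions of unity. -/
structure IsDyadicResolution {n : ℕ} (θ : ℕ → 𝓢(Eucl n, ℂ)) : Prop where
  tsupport_zero : tsupport (θ 0) ⊆ {x | ‖x‖ ≤ 2}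
  tsupport_pos : ∀ j : ℕ, 1 ≤ j →
    tsupport (θ j) ⊆ {x | (2 : ℝ) ^ ((j : ℤ) - 1) ≤ ‖x‖ ∧ ‖x‖ ≤ (2 : ℝ) ^ ((j : ℤ) + 1)}
  bound : ∀ k : ℕ, ∃ c : ℝ, 0 < c ∧ ∀ (j : ℕ) (x : Eucl n),
    (2 : ℝ) ^ (j * k) * ‖iteratedFDeriv ℝ k (θ j) x‖ ≤ c
  sum_eq_one : ∀ x : Eucl n, HasSum (fun j => θ j x) 1

/-- `θ(D) f = 𝓕⁻¹[θ · 𝓕 f]` for `f ∈ 𝒮'(ℝⁿ)`, where `𝓕` has the kernel `exp (-i x·ξ)`.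
Mathlib's Fourier transform has the kernel `exp (-2πi x·ξ)`, whence the dilation by `2π`. -/
def multiplier {n : ℕ} (θ : 𝓢(Eucl n, ℂ)) (f : 𝓢'(Eucl n, ℂ)) : 𝓢'(Eucl n, ℂ) :=
  TemperedDistribution.fourierMultiplierCLM ℂ (fun ξ => θ ((2 * Real.pi) • ξ)) f

/-- The tempered distribution `T` is given by integration against the function `h`.
Such an `h` is locally integrable and is determined by `T` almost everywhere. -/
def Represents {n : ℕ} (h : Eucl n → ℂ) (T : 𝓢'(Eucl n, ℂ)) : Prop :=
  ∀ φ : 𝓢(Eucl n, ℂ), Integrable (fun x => φ x * h x) ∧ T φ = ∫ x, φ x * h x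

/-- The weighted sequence `(2^{j s(·)} h_j)_j`. -/
def weighted {n : ℕ} (s : Eucl n → ℝ) (h : ℕ → Eucl n → ℂ) : ℕ → Eucl n → ℂ :=
  fun j x => (((2 : ℝ) ^ ((j : ℝ) * s x) : ℝ) : ℂ) * h j x

/-! ### Besov and Triebel–Lizorkin spaces on `ℝⁿ`

The distributions `θ_j(D) f` are functions; the infimum below runs over their representatives
`h_j`, all of which agree almost everywhere and so give the same value. -/

/-- The norm of `B^{s(·)}_{p(·),q(·)}(ℝⁿ)`. -/
def besovNorm {n : ℕ} (θ : ℕ → 𝓢(Eucl n, ℂ)) (p q s : Eucl n → ℝ) (f : 𝓢'(Eucl n, ℂ)) : ℝ≥0∞ :=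
  ⨅ (h : ℕ → Eucl n → ℂ) (_ : ∀ j, Represents (h j) (multiplier (θ j) f)),
    normLqLp p q (weighted s h)

/-- The norm of `F^{s(·)}_{p(·),q(·)}(ℝⁿ)`. -/
def triebelNorm {n : ℕ} (θ : ℕ → 𝓢(Eucl n, ℂ)) (p q s : Eucl n → ℝ) (f : 𝓢'(Eucl n, ℂ)) :
    ℝ≥0∞ :=
  ⨅ (h : ℕ → Eucl n → ℂ) (_ : ∀ j, Represents (h j) (multiplier (θ j) f)),
    normLpLq p q (weighted s h)

/-- `B^{s(·)}_{p(·),q(·)}(ℝⁿ)`. -/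
def besovSpace {n : ℕ} (θ : ℕ → 𝓢(Eucl n, ℂ)) (p q s : Eucl n → ℝ) : Set 𝓢'(Eucl n, ℂ) :=
  {f | besovNorm θ p q s f < ∞}

/-- `F^{s(·)}_{p(·),q(·)}(ℝⁿ)`. -/
def triebelSpace {n : ℕ} (θ : ℕ → 𝓢(Eucl n, ℂ)) (p q s : Eucl n → ℝ) : Set 𝓢'(Eucl n, ℂ) :=
  {f | triebelNorm θ p q s f < ∞}

/-! ### Restriction to the half space -/

/-- The open upper half space of `ℝⁿ⁺¹`: the last coordinate is positive. -/
def upperHalf (n : ℕ) : TopologicalSpace.Opens (Eucl (n + 1)) where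
  carrier := {x | 0 < x (Fin.last n)}
  is_open' := isOpen_lt continuous_const (by fun_prop)

/-- A real test function on `Ω`, seen as a complex Schwartz function on `ℝⁿ`. -/
def testToSchwartz {n : ℕ} {Ω : TopologicalSpace.Opens (Eucl n)} (φ : 𝓓(Ω, ℝ)) :
    𝓢(Eucl n, ℂ) :=
  HasCompactSupport.toSchwartzMap (f := fun x => ((φ x : ℝ) : ℂ))
    (φ.hasCompactSupport.comp_left (g := fun t : ℝ => (t : ℂ)) Complex.ofReal_zero)
    (Complex.ofRealCLM.contDiff.comp φ.contDiff)

theorem testToSchwartz_apply {n : ℕ} {Ω : TopologicalSpace.Opens (Eucl n)} (φ : 𝓓(Ω, ℝ))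
    (x : Eucl n) : testToSchwartz φ x = ((φ x : ℝ) : ℂ) := rfl

theorem continuous_testToSchwartz_comp {n : ℕ} {Ω : TopologicalSpace.Opens (Eucl n)}
    (K : TopologicalSpace.Compacts (Eucl n)) (hK : (K : Set (Eucl n)) ⊆ Ω) :
    Continuous ((testToSchwartz (Ω := Ω)) ∘ TestFunction.ofSupportedIn hK) := by
  let L : 𝓓_{K}(Eucl n, ℝ) →ₗ[ℝ] 𝓢(Eucl n, ℂ) :=
    { toFun := fun f => testToSchwartz (TestFunction.ofSupportedIn hK f)
      map_add' := fun f g => by ext x; simp [testToSchwartz_apply]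
      map_smul' := fun c f => by ext x; simp [testToSchwartz_apply] }
  obtain ⟨R, hR⟩ := K.isCompact.isBounded.exists_norm_le
  have hR' : (0 : ℝ) ≤ max R 0 := le_max_right _ _
  change Continuous L
  refine WithSeminorms.continuous_of_isBounded
    (ContDiffMapSupportedIn.withSeminorms ℝ (Eucl n) ℝ ⊤ K)
    (schwartz_withSeminorms ℝ (Eucl n) ℂ) L fun m => ?_
  refine ⟨{m.2}, ⟨(max R 0) ^ m.1, by positivity⟩, fun f => ?_⟩
  have hN : (0 : ℝ) ≤ ContDiffMapSupportedIn.seminorm ℝ (Eucl n) ℝ ⊤ K m.2 f := apply_nonneg _ _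
  refine SchwartzMap.seminorm_le_bound ℝ m.1 m.2 (L f) (by simp) fun x => ?_
  have h1 : ‖iteratedFDeriv ℝ m.2 (L f) x‖ = ‖iteratedFDeriv ℝ m.2 f x‖ :=
    Complex.ofRealLI.norm_iteratedFDeriv_comp_left (f := f) (x := x)
      (f.contDiff.contDiffAt) (by exact_mod_cast le_top)
  rw [h1]
  by_cases hx : x ∈ K
  · have h2 : ‖x‖ ≤ max R 0 := (hR x hx).trans (le_max_left _ _)
    have h3 : ‖iteratedFDeriv ℝ m.2 f x‖ ≤
        ContDiffMapSupportedIn.seminorm ℝ (Eucl n) ℝ ⊤ K m.2 f :=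
      ContDiffMapSupportedIn.norm_iteratedFDeriv_apply_le_seminorm_top ℝ
    simp only [Finset.sup_singleton]
    calc ‖x‖ ^ m.1 * ‖iteratedFDeriv ℝ m.2 f x‖
        ≤ (max R 0) ^ m.1 * ContDiffMapSupportedIn.seminorm ℝ (Eucl n) ℝ ⊤ K m.2 f := by gcongr
      _ = _ := rfl
  · rw [f.iteratedFDeriv_zero_on_compl hx]
    simp only [Finset.sup_singleton, Pi.zero_apply, norm_zero, mul_zero]
    exact mul_nonneg (pow_nonneg hR' _) hN

/-- The inclusion of test functions on `Ω` into Schwartz functions, as a continuous map. -/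
def testToSchwartzCLM {n : ℕ} (Ω : TopologicalSpace.Opens (Eucl n)) :
    𝓓(Ω, ℝ) →L[ℝ] 𝓢(Eucl n, ℂ) :=
  TestFunction.mkCLM ℝ testToSchwartz
    (fun f g => by ext x; simp [testToSchwartz_apply])
    (fun c f => by ext x; simp [testToSchwartz_apply])
    (fun K hK => continuous_testToSchwartz_comp K hK)

/-- The restriction `g|_Ω ∈ 𝒟'(Ω)` of `g ∈ 𝒮'(ℝⁿ)`. (Distributions on `Ω` are tested against real
test functions in Mathlib; this is the same as testing against complex ones.) -/
def restrict {n : ℕ} (Ω : TopologicalSpace.Opens (Eucl n)) (g : 𝓢'(Eucl n, ℂ)) : 𝓓'(Ω, ℂ) where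
  toFun φ := g (testToSchwartzCLM Ω φ)
  map_add' _ _ := by simp
  map_smul' c φ := by
    have h : testToSchwartzCLM Ω (c • φ) = (c : ℂ) • testToSchwartzCLM Ω φ := by
      ext x; simp [testToSchwartzCLM, testToSchwartz_apply]
    rw [h, map_smul]
    simp
  cont := (map_continuous g).comp (testToSchwartzCLM Ω).continuous

/-- The image of `A ⊆ 𝒮'(ℝⁿ)` under restriction to `Ω`. -/
def restrictedSpace {n : ℕ} (Ω : TopologicalSpace.Opens (Eucl n)) (A : Set 𝓢'(Eucl n, ℂ)) :
    Set 𝓓'(Ω, ℂ) :=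
  {f | ∃ g ∈ A, f = restrict Ω g}

/-- The infimum of `N g` over all `g ∈ A` with `f = g|_Ω`. -/
def restrictedNorm {n : ℕ} (Ω : TopologicalSpace.Opens (Eucl n)) (A : Set 𝓢'(Eucl n, ℂ))
    (N : 𝓢'(Eucl n, ℂ) → ℝ≥0∞) (f : 𝓓'(Ω, ℂ)) : ℝ≥0∞ :=
  ⨅ (g : 𝓢'(Eucl n, ℂ)) (_ : g ∈ A ∧ f = restrict Ω g), N g

/-- `B^{s(·)}_{p(·),q(·)}` on the upper half space. -/
def besovHalfSpace {n : ℕ} (θ : ℕ → 𝓢(Eucl (n + 1), ℂ)) (p q s : Eucl (n + 1) → ℝ) :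
    Set 𝓓'(upperHalf n, ℂ) :=
  restrictedSpace (upperHalf n) (besovSpace θ p q s)

/-- The norm of `B^{s(·)}_{p(·),q(·)}` on the upper half space. -/
def besovHalfNorm {n : ℕ} (θ : ℕ → 𝓢(Eucl (n + 1), ℂ)) (p q s : Eucl (n + 1) → ℝ) :
    𝓓'(upperHalf n, ℂ) → ℝ≥0∞ :=
  restrictedNorm (upperHalf n) (besovSpace θ p q s) (besovNorm θ p q s)

/-- `F^{s(·)}_{p(·),q(·)}` on the upper half space. -/
def triebelHalfSpace {n : ℕ} (θ : ℕ → 𝓢(Eucl (n + 1), ℂ)) (p q s : Eucl (n + 1) → ℝ) :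
    Set 𝓓'(upperHalf n, ℂ) :=
  restrictedSpace (upperHalf n) (triebelSpace θ p q s)

/-- The norm of `F^{s(·)}_{p(·),q(·)}` on the upper half space. -/
def triebelHalfNorm {n : ℕ} (θ : ℕ → 𝓢(Eucl (n + 1), ℂ)) (p q s : Eucl (n + 1) → ℝ) :
    𝓓'(upperHalf n, ℂ) → ℝ≥0∞ :=
  restrictedNorm (upperHalf n) (triebelSpace θ p q s) (triebelNorm θ p q s)

/-! ### Quasi-Banach spaces -/

/-- The subset `S` of the complex vector space `V`, with `N` restricted to `S`, is a quasi-Banach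
space: `S` is a linear subspace, `N` is a (finite) quasi-norm on `S`, and every `N`-Cauchy
sequence in `S` converges to an element of `S`. -/
structure IsQuasiBanach {V : Type*} [AddCommGroup V] [Module ℂ V] (S : Set V) (N : V → ℝ≥0∞) :
    Prop where
  zero_mem : (0 : V) ∈ S
  add_mem : ∀ f ∈ S, ∀ g ∈ S, f + g ∈ S
  smul_mem : ∀ (c : ℂ), ∀ f ∈ S, c • f ∈ S
  finite : ∀ f ∈ S, N f < ∞
  eq_zero_iff : ∀ f ∈ S, N f = 0 ↔ f = 0
  smul : ∀ (c : ℂ), ∀ f ∈ S, N (c • f) = ‖c‖ₑ * N f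
  quasi_triangle : ∃ K : ℝ≥0∞, 1 ≤ K ∧ K ≠ ∞ ∧ ∀ f ∈ S, ∀ g ∈ S, N (f + g) ≤ K * (N f + N g)
  complete : ∀ u : ℕ → V, (∀ k, u k ∈ S) →
    (∀ ε : ℝ≥0∞, 0 < ε → ∃ k₀ : ℕ, ∀ k ≥ k₀, ∀ l ≥ k₀, N (u k - u l) < ε) →
    ∃ f ∈ S, Tendsto (fun k => N (u k - f)) atTop (𝓝 0)

end VarExp

end

/-!
Both norms are Minkowski gauges of modulars on sequences of functions: the norm of `f` is the
infimum of all `a` such that `M (|2^{j s(·)} θ_j(D) f| / a) ≤ 1`, where `M` is the modular of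
`L^{p(·)}(ℓ^{q(·)})` or of `ℓ^{q(·)}(L^{p(·)})`. The two modulars share the properties collected in
`IsSeqModular`: monotonicity, the Fatou property, control of the `L^{p(·)}` modular of each member
of the sequence, and `α`-convexity, that is, `M (A F + B G) ≤ 1` whenever `M F ≤ 1`, `M G ≤ 1` and
`A ^ α + B ^ α ≤ 1`. The exponent `α` is the one in the two triangle inequalities
(`isSeqModular_modularLpLq`, `isSeqModular_modularLqLp`), and the gauge of an `α`-convex modular
satisfies the `α`-triangle inequality (`IsSeqModular.add_div_le`).

The remaining point is the continuous embedding into tempered distributions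
(`exists_norm_apply_le`), which gives definiteness of the norm and, with the Fatou property,
completeness. It rests on a sup bound for `h = θ_j(D) f` (`IsDyadicResolution.exists_sup_bound`): if
`κ` is the inverse Fourier transform of a cutoff equal to one near the support of `θ_j`, then
`H = H ⋆ κ` for `H = 𝓕 b · h`, where `b` is a smooth bump with small support. Since `H` is
integrable, it is bounded, and its essential supremum `K` satisfies `K ≤ K ^ (1 - r) * D` with `D`
bounding `|H| ^ r ⋆ |κ|`; here `r ≤ min(p⁻, 1)`, so `D` is controlled by the `L^{p(·)}` modular of
`2^{j s(·)} h`. Hence `K ≤ D ^ (1 / r)` (`ae_enorm_le_of_eq_conv`), and letting `𝓕 b` tend to one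
bounds `h` by a constant that grows at most exponentially in `j`. Against a test function the
dyadic blocks decay faster than any exponential in `j`
(`IsDyadicResolution.exists_integral_block_le`), and summation over `j` gives the embedding.

A series of distributions with summable norms therefore converges, its dyadic pieces are the sums
of the pieces of its terms, and Fatou's lemma turns the finite `α`-triangle inequality into the
countable one (`exists_hasSum_admissible`). Everything passes to the half space by choosing nearly
optimal extensions (`isGauge_restrictAdmissible`), and an `α`-norm with the countable triangle
inequality is complete (`IsGauge.complete`).
-/

noncomputable section

namespace VarExp

/-! ### Convexity inequalities for powers in `[0, ∞]` -/

theorem rpow_add_le_of_add_le_one {w₁ w₂ : ℝ≥0∞} (hw : w₁ + w₂ ≤ 1) (z₁ z₂ : ℝ≥0∞) {k : ℝ}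
    (hk : 1 ≤ k) : (w₁ * z₁ + w₂ * z₂) ^ k ≤ w₁ * z₁ ^ k + w₂ * z₂ ^ k := by
  have hk0 : 0 < k := by linarith
  have h := ENNReal.rpow_arith_mean_le_arith_mean_rpow Finset.univ ![w₁, w₂, 1 - (w₁ + w₂)]
    ![z₁, z₂, 0] (by simp [Fin.sum_univ_succ, ← add_assoc, hw]) hk
  simpa [Fin.sum_univ_succ, ENNReal.zero_rpow_of_pos hk0] using h

theorem rpow_rpow_div {t : ℝ} (ht : 0 < t) (u : ℝ≥0∞) (P : ℝ) : (u ^ t) ^ (P / t) = u ^ P := by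
  rw [← ENNReal.rpow_mul, mul_div_cancel₀ _ ht.ne']

/-- The `t`-convexity of `u ↦ u ^ P` for `t ≤ min 1 P`. -/
theorem rpow_add_le_of_rpow_add_le_one {t P : ℝ} (ht : 0 < t) (ht1 : t ≤ 1) (htP : t ≤ P)
    {A B : ℝ≥0∞} (hAB : A ^ t + B ^ t ≤ 1) (u v : ℝ≥0∞) :
    (A * u + B * v) ^ P ≤ A ^ t * u ^ P + B ^ t * v ^ P := by
  have hP : 1 ≤ P / t := by rwa [le_div_iff₀ ht, one_mul]
  calc (A * u + B * v) ^ P = ((A * u + B * v) ^ t) ^ (P / t) := (rpow_rpow_div ht _ _).symm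
    _ ≤ (A ^ t * u ^ t + B ^ t * v ^ t) ^ (P / t) := by
        refine ENNReal.rpow_le_rpow ?_ (by linarith)
        rw [← ENNReal.mul_rpow_of_nonneg _ _ ht.le, ← ENNReal.mul_rpow_of_nonneg _ _ ht.le]
        exact ENNReal.rpow_add_le_add_rpow _ _ ht.le ht1
    _ ≤ A ^ t * (u ^ t) ^ (P / t) + B ^ t * (v ^ t) ^ (P / t) :=
        rpow_add_le_of_add_le_one hAB _ _ hP
    _ = _ := by rw [rpow_rpow_div ht, rpow_rpow_div ht]

theorem rpow_le_of_rpow_add_le_one {α : ℝ} (hα : 0 < α) {A B : ℝ≥0∞} (h : A ^ α + B ^ α ≤ 1) :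
    A ≤ 1 ∧ B ≤ 1 := by
  constructor
  · rw [← ENNReal.rpow_le_rpow_iff hα, ENNReal.one_rpow]; exact le_self_add.trans h
  · rw [← ENNReal.rpow_le_rpow_iff hα, ENNReal.one_rpow]; exact le_add_self.trans h

theorem liminf_rpow {z : ℝ} (hz : 0 ≤ z) (u : ℕ → ℝ≥0∞) :
    (liminf u atTop) ^ z = liminf (fun L => u L ^ z) atTop :=
  (ENNReal.monotone_rpow_of_nonneg hz).map_liminf_of_continuousAt u
    ENNReal.continuous_rpow_const.continuousAt

theorem liminf_div {a : ℝ≥0∞} (ha : a ≠ 0) (u : ℕ → ℝ≥0∞) :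
    (liminf u atTop) / a = liminf (fun L => u L / a) atTop :=
  Monotone.map_liminf_of_continuousAt (f := fun x : ℝ≥0∞ => x / a)
    (fun _ _ h => ENNReal.div_le_div_right h a) u
    (ENNReal.continuous_div_const a ha).continuousAt

theorem tsum_liminf_le {u : ℕ → ℕ → ℝ≥0∞} :
    ∑' j, liminf (fun L => u L j) atTop ≤ liminf (fun L => ∑' j, u L j) atTop := by
  simp_rw [← lintegral_count]
  exact lintegral_liminf_le fun L => measurable_of_countable _

/-- Minkowski's inequality for series in `[0, ∞]`. -/
theorem tsum_Lp_add_le (f g : ℕ → ℝ≥0∞) {k : ℝ} (hk : 1 ≤ k) :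
    (∑' j, (f j + g j) ^ k) ^ (1 / k) ≤ (∑' j, f j ^ k) ^ (1 / k) + (∑' j, g j ^ k) ^ (1 / k) := by
  simp_rw [← lintegral_count]
  exact ENNReal.lintegral_Lp_add_le (measurable_of_countable f).aemeasurable
    (measurable_of_countable g).aemeasurable hk

theorem tsum_Lp_mul (c : ℝ≥0∞) (f : ℕ → ℝ≥0∞) {k : ℝ} (hk : 0 < k) :
    (∑' j, (c * f j) ^ k) ^ (1 / k) = c * (∑' j, f j ^ k) ^ (1 / k) := by
  simp_rw [ENNReal.mul_rpow_of_nonneg _ _ hk.le]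
  rw [ENNReal.tsum_mul_left, ENNReal.mul_rpow_of_nonneg _ _ (by positivity), ← ENNReal.rpow_mul,
    mul_one_div_cancel hk.ne', ENNReal.rpow_one]

/-! ### Luxemburg norms -/

section Lux

variable {n : ℕ} {p q : Eucl n → ℝ}

theorem aemeasurable_modular (hp : Measurable p) {F : Eucl n → ℝ≥0∞} (hF : AEMeasurable F) :
    AEMeasurable (fun x => F x ^ p x) :=
  hF.pow hp.aemeasurable

theorem lintegral_liminf_rpow_le (hp : Measurable p) (hp0 : ∀ x, 0 < p x)
    {F : ℕ → Eucl n → ℝ≥0∞} (hF : ∀ L, AEMeasurable (F L)) :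
    ∫⁻ x, (liminf (fun L => F L x) atTop) ^ p x ≤ liminf (fun L => ∫⁻ x, F L x ^ p x) atTop := by
  simp_rw [fun x => liminf_rpow (hp0 x).le (fun L => F L x)]
  exact lintegral_liminf_le' fun L => aemeasurable_modular hp (hF L)

/-- The infimum in the Luxemburg norm is attained. -/
theorem luxNorm_le_iff (hp : Measurable p) (hp0 : ∀ x, 0 < p x) {F : Eucl n → ℝ≥0∞}
    (hF : AEMeasurable F) {a : ℝ≥0∞} (ha : a ≠ 0) (ha' : a ≠ ∞) :
    luxNorm p F ≤ a ↔ ∫⁻ x, (F x / a) ^ p x ≤ 1 := by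
  refine ⟨fun h => ?_, fun h => sInf_le ⟨pos_iff_ne_zero.2 ha, ha', h⟩⟩
  obtain ⟨b, -, hb, hb'⟩ := exists_seq_strictAnti_tendsto' ha'.lt_top
  have hle : ∀ k, ∫⁻ x, (F x / b k) ^ p x ≤ 1 := fun k => by
    obtain ⟨μ, ⟨-, -, hμ⟩, hμb⟩ := sInf_lt_iff.1 (lt_of_le_of_lt h (hb k).1)
    refine le_trans (lintegral_mono fun x => ?_) hμ
    exact ENNReal.rpow_le_rpow (ENNReal.div_le_div_left hμb.le _) (hp0 x).le
  have hlim : ∀ x, F x / a = liminf (fun k => F x / b k) atTop := fun x =>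
    (ENNReal.Tendsto.const_div hb' (Or.inl ha')).liminf_eq.symm
  simp_rw [hlim]
  refine (lintegral_liminf_rpow_le hp hp0 fun k => hF.div_const _).trans ?_
  exact (liminf_le_liminf (Eventually.of_forall hle)).trans_eq (by simp)

theorem luxNorm_mono (hp0 : ∀ x, 0 < p x) {F G : Eucl n → ℝ≥0∞} (h : F ≤ᵐ[volume] G) :
    luxNorm p F ≤ luxNorm p G := by
  refine sInf_le_sInf fun μ hμ => ⟨hμ.1, hμ.2.1, (lintegral_mono_ae ?_).trans hμ.2.2⟩
  filter_upwards [h] with x hx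
  exact ENNReal.rpow_le_rpow (ENNReal.div_le_div_right hx _) (hp0 x).le

theorem luxNorm_zero (hp0 : ∀ x, 0 < p x) : luxNorm p (fun _ => 0) = 0 := by
  refine le_antisymm (le_of_forall_gt fun c hc => ?_) bot_le
  obtain ⟨d, hd, hdc⟩ := exists_between hc
  refine lt_of_le_of_lt (sInf_le ⟨hd, hdc.ne_top, ?_⟩) hdc
  simp [ENNReal.zero_rpow_of_pos (hp0 _)]

/-- The Fatou property of the Luxemburg norm. -/
theorem luxNorm_liminf_le (hp : Measurable p) (hp0 : ∀ x, 0 < p x)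
    {F : ℕ → Eucl n → ℝ≥0∞} (hF : ∀ L, AEMeasurable (F L)) :
    luxNorm p (fun x => liminf (fun L => F L x) atTop) ≤
      liminf (fun L => luxNorm p (F L)) atTop := by
  refine le_of_forall_gt_imp_ge_of_dense fun l hl => ?_
  rcases eq_or_ne l ∞ with rfl | hl'
  · exact le_top
  have hl0 : l ≠ 0 := (bot_le.trans_lt hl).ne'
  refine sInf_le ⟨pos_iff_ne_zero.2 hl0, hl', ?_⟩
  simp_rw [liminf_div hl0]
  refine (lintegral_liminf_rpow_le hp hp0 fun k => (hF k).div_const _).trans ?_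
  refine liminf_le_of_frequently_le ?_
  refine (frequently_lt_of_liminf_lt (by isBoundedDefault) hl).mono fun L hL => ?_
  exact (luxNorm_le_iff hp hp0 (hF L) hl0 hl').1 hL.le

/-- The `t`-convexity of the modular of `L^{p(·)}` for `t ≤ min 1 p⁻`. -/
theorem lintegral_add_rpow_le {t : ℝ} (ht : 0 < t) (ht1 : t ≤ 1) (hp : Measurable p)
    (htp : ∀ᵐ x ∂(volume : Measure (Eucl n)), t ≤ p x) {A B : ℝ≥0∞} (hAB : A ^ t + B ^ t ≤ 1)
    {F G : Eucl n → ℝ≥0∞} (hF : AEMeasurable F)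
    (hF1 : ∫⁻ x, F x ^ p x ≤ 1) (hG1 : ∫⁻ x, G x ^ p x ≤ 1) :
    ∫⁻ x, (A * F x + B * G x) ^ p x ≤ 1 := by
  have hA := (ENNReal.rpow_lt_top_of_nonneg ht.le
    ((rpow_le_of_rpow_add_le_one ht hAB).1.trans_lt ENNReal.one_lt_top).ne).ne
  have hB := (ENNReal.rpow_lt_top_of_nonneg ht.le
    ((rpow_le_of_rpow_add_le_one ht hAB).2.trans_lt ENNReal.one_lt_top).ne).ne
  calc ∫⁻ x, (A * F x + B * G x) ^ p x
      ≤ ∫⁻ x, (A ^ t * F x ^ p x + B ^ t * G x ^ p x) := by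
        refine lintegral_mono_ae ?_
        filter_upwards [htp] with x hx
        exact rpow_add_le_of_rpow_add_le_one ht ht1 hx hAB _ _
    _ = A ^ t * (∫⁻ x, F x ^ p x) + B ^ t * ∫⁻ x, G x ^ p x := by
        rw [lintegral_add_left' ((aemeasurable_modular hp hF).const_mul _),
          lintegral_const_mul' _ _ hA, lintegral_const_mul' _ _ hB]
    _ ≤ A ^ t * 1 + B ^ t * 1 := by gcongr
    _ ≤ 1 := by simpa using hAB

/-- The triangle inequality for the `t`-th power of the Luxemburg norm, in convex form. -/
theorem luxNorm_add_le {t : ℝ} (ht : 0 < t) (ht1 : t ≤ 1) (hp : Measurable p)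
    (hp0 : ∀ x, 0 < p x)
    (htp : ∀ᵐ x ∂(volume : Measure (Eucl n)), t ≤ p x) {A B : ℝ≥0∞} (hAB : A ^ t + B ^ t ≤ 1)
    {F G : Eucl n → ℝ≥0∞} (hF : AEMeasurable F) (hG : AEMeasurable G)
    (hF1 : luxNorm p F ≠ ∞) (hG1 : luxNorm p G ≠ ∞) :
    luxNorm p (fun x => A * F x + B * G x) ≤ A ^ t * luxNorm p F + B ^ t * luxNorm p G := by
  have hA1 := (rpow_le_of_rpow_add_le_one ht hAB).1
  have hB1 := (rpow_le_of_rpow_add_le_one ht hAB).2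
  -- the estimate for arbitrary finite upper bounds `a`, `b` of the two norms
  have key : ∀ a b : ℝ≥0∞, a ≠ 0 → a ≠ ∞ → b ≠ 0 → b ≠ ∞ → luxNorm p F ≤ a → luxNorm p G ≤ b →
      luxNorm p (fun x => A * F x + B * G x) ≤ A ^ t * a + B ^ t * b := by
    intro a b ha ha' hb hb' hFa hGb
    set c := A ^ t * a + B ^ t * b with hc
    rcases eq_or_ne c 0 with hc0 | hc0
    · have h1 : A = 0 ∧ B = 0 := by
        rw [hc] at hc0
        simpa [ha, hb, ENNReal.rpow_eq_zero_iff, ht, ht.not_gt] using hc0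
      simp [h1.1, h1.2, luxNorm_zero hp0]
    have hc' : c ≠ ∞ := by
      refine ENNReal.add_ne_top.2 ⟨ENNReal.mul_ne_top ?_ ha', ENNReal.mul_ne_top ?_ hb'⟩ <;>
      refine ENNReal.rpow_ne_top_of_nonneg ht.le (ne_top_of_le_ne_top ENNReal.one_ne_top ?_)
      exacts [hA1, hB1]
    refine (luxNorm_le_iff hp hp0 ((hF.const_mul _).add (hG.const_mul _)) hc0 hc').2 ?_
    have hsum : (A * a / c) ^ t + (B * b / c) ^ t ≤ 1 := by
      rw [ENNReal.div_rpow_of_nonneg _ _ ht.le, ENNReal.div_rpow_of_nonneg _ _ ht.le,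
        ENNReal.div_add_div_same, ENNReal.mul_rpow_of_nonneg _ _ ht.le,
        ENNReal.mul_rpow_of_nonneg _ _ ht.le]
      refine ENNReal.div_le_of_le_mul ?_
      rw [one_mul]
      have h2 := rpow_add_le_of_add_le_one hAB (a ^ t) (b ^ t) (k := 1 / t)
        (by rw [le_div_iff₀ ht]; simpa using ht1)
      rw [rpow_rpow_div ht, rpow_rpow_div ht, ENNReal.rpow_one, ENNReal.rpow_one] at h2
      calc _ = ((A ^ t * a ^ t + B ^ t * b ^ t) ^ (1 / t)) ^ t := by
            rw [← ENNReal.rpow_mul, one_div_mul_cancel ht.ne', ENNReal.rpow_one]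
        _ ≤ _ := ENNReal.rpow_le_rpow h2 ht.le
    have h3 := lintegral_add_rpow_le ht ht1 hp htp hsum (hF.div_const a)
      ((luxNorm_le_iff hp hp0 hF ha ha').1 hFa) ((luxNorm_le_iff hp hp0 hG hb hb').1 hGb)
    have h4 : ∀ (X Y z : ℝ≥0∞), z ≠ 0 → z ≠ ∞ → X * z / c * (Y / z) = X * Y / c := by
      intro X Y z hz hz'
      simp only [div_eq_mul_inv]
      calc X * z * c⁻¹ * (Y * z⁻¹) = X * Y * c⁻¹ * (z * z⁻¹) := by ring
        _ = _ := by rw [ENNReal.mul_inv_cancel hz hz', mul_one]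
    simp_rw [h4 _ _ a ha ha', h4 _ _ b hb hb', ENNReal.div_add_div_same] at h3
    exact h3
  refine ENNReal.le_of_forall_pos_le_add fun ε hε _ => ?_
  have hε' : (ε : ℝ≥0∞) ≠ 0 := by exact_mod_cast hε.ne'
  refine (key (luxNorm p F + ε) (luxNorm p G + ε) (by simp [hε']) (by simp [hF1]) (by simp [hε'])
    (by simp [hG1]) le_self_add le_self_add).trans ?_
  calc A ^ t * (luxNorm p F + ε) + B ^ t * (luxNorm p G + ε)
      = A ^ t * luxNorm p F + B ^ t * luxNorm p G + (A ^ t + B ^ t) * ε := by ring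
    _ ≤ A ^ t * luxNorm p F + B ^ t * luxNorm p G + 1 * ε := by gcongr
    _ = _ := by rw [one_mul]

end Lux

/-! ### Modulars of sequences of functions -/

/-- The properties of a modular `M` on sequences of `[0, ∞]`-valued functions that make its
Minkowski gauge a complete `α`-norm on spaces of distributions: monotonicity, the Fatou property,
`α`-convexity, and control of the `L^{p(·)}` modular of each member of the sequence. -/
structure IsSeqModular {n : ℕ} (p : Eucl n → ℝ) (α : ℝ)
    (M : (ℕ → Eucl n → ℝ≥0∞) → ℝ≥0∞) : Prop where
  zero : M (fun _ _ => 0) ≤ 1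
  mono : ∀ F G : ℕ → Eucl n → ℝ≥0∞, (∀ j, F j ≤ᵐ[volume] G j) → M F ≤ M G
  fatou : ∀ F : ℕ → ℕ → Eucl n → ℝ≥0∞, (∀ L j, AEMeasurable (F L j)) → (∀ L, M (F L) ≤ 1) →
    M (fun j x => liminf (fun L => F L j x) atTop) ≤ 1
  convex : ∀ F G : ℕ → Eucl n → ℝ≥0∞, (∀ j, AEMeasurable (F j)) → (∀ j, AEMeasurable (G j)) →
    ∀ A B : ℝ≥0∞, A ^ α + B ^ α ≤ 1 → M F ≤ 1 → M G ≤ 1 →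
    M (fun j x => A * F j x + B * G j x) ≤ 1
  component : ∀ F : ℕ → Eucl n → ℝ≥0∞, (∀ j, AEMeasurable (F j)) → M F ≤ 1 →
    ∀ j, ∫⁻ x, F j x ^ p x ≤ 1

/-- The modular of `L^{p(·)}(ℓ^{q(·)})`. -/
def modularLpLq {n : ℕ} (p q : Eucl n → ℝ) (F : ℕ → Eucl n → ℝ≥0∞) : ℝ≥0∞ :=
  ∫⁻ x, ((∑' j, F j x ^ q x) ^ (1 / q x)) ^ p x

section Modulars

variable {n : ℕ} {p q : Eucl n → ℝ}

/-- The `r`-triangle inequality of `ℓ^k` for `r ≤ min 1 k`. -/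
theorem tsum_rpow_add_le {r k : ℝ} (hr : 0 < r) (hr1 : r ≤ 1) (hrk : r ≤ k) (A B : ℝ≥0∞)
    (f g : ℕ → ℝ≥0∞) :
    ((∑' j, (A * f j + B * g j) ^ k) ^ (1 / k)) ^ r ≤
      A ^ r * ((∑' j, f j ^ k) ^ (1 / k)) ^ r + B ^ r * ((∑' j, g j ^ k) ^ (1 / k)) ^ r := by
  have hk : 0 < k := hr.trans_le hrk
  have hkr : 1 ≤ k / r := by rwa [le_div_iff₀ hr, one_mul]
  have hpow : ∀ u : ℕ → ℝ≥0∞, ((∑' j, u j ^ k) ^ (1 / k)) ^ r =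
      (∑' j, (u j ^ r) ^ (k / r)) ^ (1 / (k / r)) := fun u => by
    simp_rw [rpow_rpow_div hr, ← ENNReal.rpow_mul]
    congr 1
    field_simp
  rw [hpow, hpow, hpow]
  calc _ ≤ (∑' j, ((A ^ r * f j ^ r) + (B ^ r * g j ^ r)) ^ (k / r)) ^ (1 / (k / r)) := by
        refine ENNReal.rpow_le_rpow (ENNReal.tsum_le_tsum fun j => ?_) (by positivity)
        refine ENNReal.rpow_le_rpow ?_ (by positivity)
        rw [← ENNReal.mul_rpow_of_nonneg _ _ hr.le, ← ENNReal.mul_rpow_of_nonneg _ _ hr.le]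
        exact ENNReal.rpow_add_le_add_rpow _ _ hr.le hr1
    _ ≤ _ := tsum_Lp_add_le _ _ hkr
    _ = _ := by rw [tsum_Lp_mul _ _ (by positivity), tsum_Lp_mul _ _ (by positivity)]

/-- Here `r`-convexity combines three facts: the `r`-triangle inequality of `ℓ^{q(x)}` at each
point, the convexity of `u ↦ u ^ (p(x) / r)`, and integration. -/
theorem isSeqModular_modularLpLq (hp : Measurable p) (hq : Measurable q) (hp0 : ∀ x, 0 < p x)
    (hq0 : ∀ x, 0 < q x) {r : ℝ} (hr : 0 < r) (hr1 : r ≤ 1)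
    (hrp : ∀ᵐ x ∂(volume : Measure (Eucl n)), r ≤ p x)
    (hrq : ∀ᵐ x ∂(volume : Measure (Eucl n)), r ≤ q x) :
    IsSeqModular p r (modularLpLq p q) := by
  have hmeas : ∀ F : ℕ → Eucl n → ℝ≥0∞, (∀ j, AEMeasurable (F j)) →
      AEMeasurable (fun x => (∑' j, F j x ^ q x) ^ (1 / q x)) := fun F hF =>
    (AEMeasurable.tsum fun j => aemeasurable_modular hq (hF j)).pow
      (hq.const_div 1).aemeasurable
  have hq1 : ∀ x, 0 ≤ 1 / q x := fun x => (one_div_pos.2 (hq0 x)).le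
  refine ⟨?_, fun F G h => ?_, fun F hF hF1 => ?_, fun F G hF hG A B hAB hF1 hG1 => ?_,
    fun F hF hF1 j => ?_⟩
  · simp [modularLpLq, ENNReal.zero_rpow_of_pos (hp0 _), ENNReal.zero_rpow_of_pos (hq0 _),
      ENNReal.zero_rpow_of_pos (inv_pos.2 (hq0 _))]
  · refine lintegral_mono_ae ?_
    filter_upwards [ae_all_iff.2 h] with x hx
    refine ENNReal.rpow_le_rpow (ENNReal.rpow_le_rpow (ENNReal.tsum_le_tsum fun j => ?_) (hq1 x))
      (hp0 x).le
    exact ENNReal.rpow_le_rpow (hx j) (hq0 x).le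
  · calc _ ≤ ∫⁻ x, (liminf (fun L => (∑' j, F L j x ^ q x) ^ (1 / q x)) atTop) ^ p x := by
          refine lintegral_mono fun x => ENNReal.rpow_le_rpow ?_ (hp0 x).le
          dsimp only
          rw [← liminf_rpow (hq1 x)]
          refine ENNReal.rpow_le_rpow ?_ (hq1 x)
          simp_rw [liminf_rpow (hq0 x).le]
          exact tsum_liminf_le (u := fun L j => F L j x ^ q x)
      _ ≤ _ := lintegral_liminf_rpow_le hp hp0 fun L => hmeas _ (hF L)
      _ ≤ _ := liminf_le_liminf (Eventually.of_forall hF1)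
      _ = 1 := by simp
  · have hA := (ENNReal.rpow_lt_top_of_nonneg hr.le
      ((rpow_le_of_rpow_add_le_one hr hAB).1.trans_lt ENNReal.one_lt_top).ne).ne
    have hB := (ENNReal.rpow_lt_top_of_nonneg hr.le
      ((rpow_le_of_rpow_add_le_one hr hAB).2.trans_lt ENNReal.one_lt_top).ne).ne
    calc _ ≤ ∫⁻ x, (A ^ r * ((∑' j, F j x ^ q x) ^ (1 / q x)) ^ p x +
          B ^ r * ((∑' j, G j x ^ q x) ^ (1 / q x)) ^ p x) := by
          refine lintegral_mono_ae ?_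
          filter_upwards [hrp, hrq] with x hxp hxq
          rw [← rpow_rpow_div hr, ← rpow_rpow_div hr _ (p x), ← rpow_rpow_div hr _ (p x)]
          have hpr : 1 ≤ p x / r := by rwa [le_div_iff₀ hr, one_mul]
          refine le_trans (ENNReal.rpow_le_rpow (tsum_rpow_add_le hr hr1 hxq A B _ _)
            (by linarith)) ?_
          exact rpow_add_le_of_add_le_one hAB _ _ hpr
      _ = A ^ r * modularLpLq p q F + B ^ r * modularLpLq p q G := by
          rw [lintegral_add_left' ((aemeasurable_modular hp (hmeas F hF)).const_mul _),
            lintegral_const_mul' _ _ hA, lintegral_const_mul' _ _ hB]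
          rfl
      _ ≤ A ^ r * 1 + B ^ r * 1 := by gcongr
      _ ≤ 1 := by simpa using hAB
  · refine le_trans (lintegral_mono fun x => ?_) hF1
    refine ENNReal.rpow_le_rpow ?_ (hp0 x).le
    calc F j x = (F j x ^ q x) ^ (1 / q x) := by
          rw [← ENNReal.rpow_mul, mul_one_div_cancel (hq0 x).ne', ENNReal.rpow_one]
      _ ≤ _ := ENNReal.rpow_le_rpow (ENNReal.le_tsum j) (hq1 x)

/-- The terms of the modular of `ℓ^{q(·)}(L^{p(·)})` are Luxemburg norms of `|F j| ^ q(·)` in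
`L^{p(·)/q(·)}`. -/
theorem modularLqLp_eq (hq0 : ∀ x, 0 < q x) (F : ℕ → Eucl n → ℝ≥0∞) :
    modularLqLp p q F = ∑' j, luxNorm (fun x => p x / q x) (fun x => F j x ^ q x) := by
  have h : ∀ j (l : ℝ≥0∞) x, (F j x ^ q x / l) ^ (p x / q x) = (F j x / l ^ (1 / q x)) ^ p x := by
    intro j l x
    rw [← rpow_rpow_div (hq0 x) (F j x / l ^ (1 / q x)), ENNReal.div_rpow_of_nonneg _ _ (hq0 x).le,
      ← ENNReal.rpow_mul l, one_div_mul_cancel (hq0 x).ne', ENNReal.rpow_one]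
  simp_rw [modularLqLp, luxNorm, h]

/-- The exponent of convexity is a product: `u ↦ u ^ q(x)` is `r`-convex, and the Luxemburg norm of
`L^{p(·)/q(·)}` satisfies `‖A F + B G‖ ≤ A ^ t * ‖F‖ + B ^ t * ‖G‖` if `A ^ t + B ^ t ≤ 1`. -/
theorem isSeqModular_modularLqLp (hp : Measurable p) (hq : Measurable q) (hp0 : ∀ x, 0 < p x)
    (hq0 : ∀ x, 0 < q x) {r t : ℝ} (hr : 0 < r) (hr1 : r ≤ 1) (ht : 0 < t) (ht1 : t ≤ 1)
    (hrq : ∀ᵐ x ∂(volume : Measure (Eucl n)), r ≤ q x)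
    (htpq : ∀ᵐ x ∂(volume : Measure (Eucl n)), t ≤ p x / q x) :
    IsSeqModular p (r * t) (modularLqLp p q) := by
  have hP : Measurable (fun x => p x / q x) := hp.div hq
  have hP0 : ∀ x, 0 < p x / q x := fun x => div_pos (hp0 x) (hq0 x)
  refine ⟨?_, fun F G h => ?_, fun F hF hF1 => ?_, fun F G hF hG A B hAB hF1 hG1 => ?_,
    fun F hF hF1 j => ?_⟩
  · rw [modularLqLp_eq hq0]
    simp [ENNReal.zero_rpow_of_pos (hq0 _), luxNorm_zero hP0]
  · rw [modularLqLp_eq hq0, modularLqLp_eq hq0]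
    refine ENNReal.tsum_le_tsum fun j => luxNorm_mono hP0 ?_
    filter_upwards [h j] with x hx
    exact ENNReal.rpow_le_rpow hx (hq0 x).le
  · simp_rw [modularLqLp_eq hq0] at hF1 ⊢
    simp_rw [fun x => liminf_rpow (hq0 x).le]
    calc _ ≤ ∑' j, liminf (fun L => luxNorm (fun x => p x / q x) (fun x => F L j x ^ q x)) atTop :=
          ENNReal.tsum_le_tsum fun j =>
            luxNorm_liminf_le hP hP0 fun L => aemeasurable_modular hq (hF L j)
      _ ≤ _ := tsum_liminf_le
      _ ≤ _ := liminf_le_liminf (Eventually.of_forall hF1)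
      _ = 1 := by simp
  · rw [modularLqLp_eq hq0] at hF1 hG1 ⊢
    have hAB' : (A ^ r) ^ t + (B ^ r) ^ t ≤ 1 := by rwa [← ENNReal.rpow_mul, ← ENNReal.rpow_mul]
    have hABr : A ^ r + B ^ r ≤ 1 := by
      obtain ⟨hA1, hB1⟩ := rpow_le_of_rpow_add_le_one ht hAB'
      refine le_trans (add_le_add ?_ ?_) hAB'
      · simpa using ENNReal.rpow_le_rpow_of_exponent_ge hA1 ht1
      · simpa using ENNReal.rpow_le_rpow_of_exponent_ge hB1 ht1
    calc _ ≤ ∑' j, ((A ^ r) ^ t * luxNorm (fun x => p x / q x) (fun x => F j x ^ q x) +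
          (B ^ r) ^ t * luxNorm (fun x => p x / q x) (fun x => G j x ^ q x)) := by
          refine ENNReal.tsum_le_tsum fun j => ?_
          refine le_trans (luxNorm_mono hP0 ?_) (luxNorm_add_le ht ht1 hP hP0 htpq hAB'
            (aemeasurable_modular hq (hF j)) (aemeasurable_modular hq (hG j))
            (ne_top_of_le_ne_top ENNReal.one_ne_top ((ENNReal.le_tsum j).trans hF1))
            (ne_top_of_le_ne_top ENNReal.one_ne_top ((ENNReal.le_tsum j).trans hG1)))
          filter_upwards [hrq] with x hx
          exact rpow_add_le_of_rpow_add_le_one hr hr1 hx hABr _ _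
      _ = (A ^ r) ^ t * (∑' j, luxNorm (fun x => p x / q x) (fun x => F j x ^ q x)) +
          (B ^ r) ^ t * ∑' j, luxNorm (fun x => p x / q x) (fun x => G j x ^ q x) := by
          rw [ENNReal.tsum_add, ENNReal.tsum_mul_left, ENNReal.tsum_mul_left]
      _ ≤ (A ^ r) ^ t * 1 + (B ^ r) ^ t * 1 := by gcongr
      _ ≤ 1 := by simpa using hAB'
  · rw [modularLqLp_eq hq0] at hF1
    have h1 := (luxNorm_le_iff hP hP0 (aemeasurable_modular hq (hF j)) one_ne_zero
      ENNReal.one_ne_top).1 ((ENNReal.le_tsum j).trans hF1)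
    simpa only [div_one, rpow_rpow_div (hq0 _)] using h1

/-- The Minkowski gauge of `modularLpLq` is the norm of `L^{p(·)}(ℓ^{q(·)})`. -/
theorem normLpLq_eq (hq0 : ∀ x, 0 < q x) (g : ℕ → Eucl n → ℂ) :
    normLpLq p q g =
      sInf {μ : ℝ≥0∞ | 0 < μ ∧ μ ≠ ∞ ∧ modularLpLq p q (fun j x => ‖g j x‖ₑ / μ) ≤ 1} := by
  have h : ∀ (μ : ℝ≥0∞) x, (∑' j, (‖g j x‖ₑ / μ) ^ q x) ^ (1 / q x) =
      (∑' j, ‖g j x‖ₑ ^ q x) ^ (1 / q x) / μ := fun μ x => by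
    simp_rw [div_eq_mul_inv _ μ, mul_comm _ μ⁻¹]
    exact tsum_Lp_mul _ _ (hq0 x)
  simp_rw [normLpLq, luxNorm, modularLpLq, h]

end Modulars

/-! ### Dyadic pieces of Schwartz functions -/

section Fourier

open FourierTransform

variable {n : ℕ}

/-- The dilated symbol `ξ ↦ θ (2π ξ)`, which turns the multiplier `θ(D)` into one for the Fourier
transform with kernel `exp (-2πi x·ξ)`. -/
def symbol (θ : 𝓢(Eucl n, ℂ)) : 𝓢(Eucl n, ℂ) :=
  SchwartzMap.compCLMOfContinuousLinearEquiv ℂ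
    (ContinuousLinearEquiv.smulLeft (R₁ := ℝ) (M₁ := Eucl n)
      (Units.mk0 (2 * Real.pi) (by positivity))) θ

theorem symbol_apply (θ : 𝓢(Eucl n, ℂ)) (ξ : Eucl n) : symbol θ ξ = θ ((2 * Real.pi) • ξ) := rfl

/-- The action of `θ(D)` on a test function: `𝓕[θ(2π ·) 𝓕⁻¹ φ]`. -/
def block (θ φ : 𝓢(Eucl n, ℂ)) : 𝓢(Eucl n, ℂ) :=
  𝓕 (SchwartzMap.smulLeftCLM ℂ (symbol θ) (𝓕⁻ φ))

theorem multiplier_apply (θ : 𝓢(Eucl n, ℂ)) (f : 𝓢'(Eucl n, ℂ)) (φ : 𝓢(Eucl n, ℂ)) :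
    multiplier θ f φ = f (block θ φ) := rfl

theorem fourierInv_block (θ φ : 𝓢(Eucl n, ℂ)) :
    𝓕⁻ (block θ φ) = SchwartzMap.smulLeftCLM ℂ (symbol θ) (𝓕⁻ φ) := by
  simp [block]

theorem multiplier_smul (θ : 𝓢(Eucl n, ℂ)) (c : ℂ) (f : 𝓢'(Eucl n, ℂ)) :
    multiplier θ (c • f) = c • multiplier θ f := by
  simp [multiplier]

theorem multiplier_add (θ : 𝓢(Eucl n, ℂ)) (f g : 𝓢'(Eucl n, ℂ)) :
    multiplier θ (f + g) = multiplier θ f + multiplier θ g := by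
  simp [multiplier]

theorem norm_iteratedFDeriv_symbol (θ : 𝓢(Eucl n, ℂ)) (k : ℕ) (ξ : Eucl n) :
    ‖iteratedFDeriv ℝ k (symbol θ) ξ‖ =
      (2 * Real.pi) ^ k * ‖iteratedFDeriv ℝ k θ ((2 * Real.pi) • ξ)‖ := by
  have h := congrFun (iteratedFDeriv_comp_const_smul (i := k) (2 * Real.pi) (θ.smooth k)) ξ
  change ‖iteratedFDeriv ℝ k (fun z => θ ((2 * Real.pi) • z)) ξ‖ = _
  rw [h, norm_smul]
  simp [abs_of_pos Real.pi_pos]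

/-- The sum of the Schwartz seminorms of order at most `l` with weight `|x|^k`. -/
def sumSeminorm (k l : ℕ) : Seminorm ℂ 𝓢(Eucl n, ℂ) :=
  ∑ i ∈ Finset.range (l + 1), SchwartzMap.seminorm ℂ k i

theorem sumSeminorm_apply (k l : ℕ) (u : 𝓢(Eucl n, ℂ)) :
    sumSeminorm k l u = ∑ i ∈ Finset.range (l + 1), SchwartzMap.seminorm ℂ k i u := by
  exact sum_apply _ _ _

theorem continuous_sumSeminorm (k l : ℕ) :
    Continuous (sumSeminorm k l : Seminorm ℂ 𝓢(Eucl n, ℂ)) := by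
  have : (sumSeminorm k l : 𝓢(Eucl n, ℂ) → ℝ) =
      fun u => ∑ i ∈ Finset.range (l + 1), SchwartzMap.seminorm ℂ k i u :=
    funext fun u => sumSeminorm_apply k l u
  rw [this]
  exact continuous_finsetSum _ fun i _ =>
    (schwartz_withSeminorms ℂ (Eucl n) ℂ).continuous_seminorm (k, i)

theorem seminorm_le_sumSeminorm {k l i : ℕ} (hi : i ≤ l) (u : 𝓢(Eucl n, ℂ)) :
    SchwartzMap.seminorm ℂ k i u ≤ sumSeminorm k l u := by
  rw [sumSeminorm_apply]
  exact Finset.single_le_sum (f := fun i => SchwartzMap.seminorm ℂ k i u)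
    (fun i _ => apply_nonneg _ _) (Finset.mem_range.2 (by omega))

/-- A multiplier with bounded derivatives that vanishes in the ball of radius `R` gains the factor
`R ^ (-M)` in Schwartz seminorms, at the price of `M` more powers of `|x|`. -/
theorem seminorm_mul_le {v u : 𝓢(Eucl n, ℂ)} {m : Eucl n → ℂ} (hm : ContDiff ℝ (⊤ : ℕ∞) m)
    (hv : ∀ x, v x = m x * u x) {B R : ℝ} (hB : 0 ≤ B) (hR : 0 ≤ R) {k l M : ℕ}
    (hmB : ∀ i ≤ l, ∀ x, ‖iteratedFDeriv ℝ i m x‖ ≤ B) (hmR : ∀ x, ‖x‖ < R → m x = 0) :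
    R ^ M * SchwartzMap.seminorm ℂ k l v ≤ 2 ^ l * B * sumSeminorm (k + M) l u := by
  have hv' : (v : Eucl n → ℂ) = fun x => m x * u x := funext hv
  have hS : 0 ≤ sumSeminorm (k + M) l u := apply_nonneg _ _
  have key : ∀ x, R ^ M * (‖x‖ ^ k * ‖iteratedFDeriv ℝ l v x‖) ≤
      2 ^ l * B * sumSeminorm (k + M) l u := by
    intro x
    rcases lt_or_ge ‖x‖ R with hx | hx
    · have h0 : (v : Eucl n → ℂ) =ᶠ[𝓝 x] fun _ => 0 := by
        filter_upwards [(isOpen_lt continuous_norm continuous_const).mem_nhds hx] with y hy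
        rw [hv, hmR y hy, zero_mul]
      rw [(h0.iteratedFDeriv ℝ l).eq_of_nhds]
      simp only [iteratedFDeriv_fun_zero, Pi.zero_apply, norm_zero, mul_zero]
      positivity
    · have hl : (l : WithTop ℕ∞) ≤ ((⊤ : ℕ∞) : WithTop ℕ∞) := by exact_mod_cast le_top
      have h1 := norm_iteratedFDeriv_mul_le hm (u.smooth ⊤) x (n := l) hl
      rw [hv']
      calc R ^ M * (‖x‖ ^ k * ‖iteratedFDeriv ℝ l (fun x => m x * u x) x‖)
          ≤ ‖x‖ ^ M * (‖x‖ ^ k * ∑ i ∈ Finset.range (l + 1),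
              (l.choose i : ℝ) * ‖iteratedFDeriv ℝ i m x‖ * ‖iteratedFDeriv ℝ (l - i) u x‖) := by
            gcongr
        _ = ∑ i ∈ Finset.range (l + 1), (l.choose i : ℝ) * (‖iteratedFDeriv ℝ i m x‖ *
              (‖x‖ ^ (k + M) * ‖iteratedFDeriv ℝ (l - i) u x‖)) := by
            rw [Finset.mul_sum, Finset.mul_sum]
            exact Finset.sum_congr rfl fun i _ => by ring
        _ ≤ ∑ i ∈ Finset.range (l + 1), (l.choose i : ℝ) * (B * sumSeminorm (k + M) l u) := by
            refine Finset.sum_le_sum fun i hi => ?_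
            gcongr
            · exact hmB i (by simpa [Nat.lt_succ_iff] using hi) x
            · exact (SchwartzMap.le_seminorm ℂ _ _ u x).trans
                (seminorm_le_sumSeminorm (Nat.sub_le _ _) u)
        _ = _ := by
            rw [← Finset.sum_mul, mul_assoc]
            congr 1
            exact_mod_cast Nat.sum_range_choose l
  rcases hR.eq_or_lt with rfl | hR0
  · rcases Nat.eq_zero_or_pos M with rfl | hM
    · simp only [pow_zero, one_mul] at key ⊢
      exact SchwartzMap.seminorm_le_bound ℂ _ _ _ (by positivity) key
    · rw [zero_pow hM.ne', zero_mul]; positivity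
  · have hRM : 0 < R ^ M := by positivity
    rw [mul_comm, ← le_div_iff₀ hRM]
    refine SchwartzMap.seminorm_le_bound ℂ _ _ _ (by positivity) fun x => ?_
    rw [le_div_iff₀ hRM, mul_comm]
    exact key x

/-- A bound on a continuous seminorm of `A w` by finitely many Schwartz seminorms of `w`. -/
theorem exists_seminorm_comp_le (A : 𝓢(Eucl n, ℂ) →L[ℂ] 𝓢(Eucl n, ℂ)) (k l : ℕ) :
    ∃ (s : Finset (ℕ × ℕ)) (C : ℝ), 0 ≤ C ∧ ∀ w : 𝓢(Eucl n, ℂ), ∀ a : ℝ, 0 ≤ a →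
      (∀ m ∈ s, SchwartzMap.seminorm ℂ m.1 m.2 w ≤ a) →
      SchwartzMap.seminorm ℂ k l (A w) ≤ C * a := by
  have hc : Continuous ((SchwartzMap.seminorm ℂ k l).comp A.toLinearMap) :=
    ((schwartz_withSeminorms ℂ (Eucl n) ℂ).continuous_seminorm (k, l)).comp A.continuous
  obtain ⟨s, C, -, hC⟩ := Seminorm.bound_of_continuous (schwartz_withSeminorms ℂ (Eucl n) ℂ) _ hc
  refine ⟨s, C, C.2, fun w a ha h => (hC w).trans ?_⟩
  rw [smul_apply, NNReal.smul_def, smul_eq_mul]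
  exact mul_le_mul_of_nonneg_left (Seminorm.finset_sup_apply_le ha h) C.2

/-! ### Dyadic resolutions of unity -/

namespace IsDyadicResolution

variable {θ : ℕ → 𝓢(Eucl n, ℂ)}

theorem norm_le_of_ne_zero (hθ : IsDyadicResolution θ) {j : ℕ} {y : Eucl n} (h : θ j y ≠ 0) :
    ‖y‖ ≤ 2 ^ (j + 1) := by
  have hy : y ∈ tsupport (θ j) := subset_tsupport _ h
  rcases Nat.eq_zero_or_pos j with rfl | hj
  · simpa using hθ.tsupport_zero hy
  · have := (hθ.tsupport_pos j hj hy).2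
    exact_mod_cast this

theorem le_norm_of_ne_zero (hθ : IsDyadicResolution θ) {j : ℕ} (hj : 1 ≤ j) {y : Eucl n}
    (h : θ j y ≠ 0) : 2 ^ j ≤ 2 * ‖y‖ := by
  have h1 := (hθ.tsupport_pos j hj (subset_tsupport _ h)).1
  rw [zpow_sub₀ two_ne_zero, zpow_one, zpow_natCast] at h1
  linarith

theorem sum_range_eq_one (hθ : IsDyadicResolution θ) {J : ℕ} (hJ : 1 ≤ J) {y : Eucl n}
    (hy : 2 * ‖y‖ < 2 ^ J) : ∑ j ∈ Finset.range J, θ j y = 1 := by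
  refine HasSum.unique (hasSum_sum_of_ne_finset_zero fun j hj => ?_) (hθ.sum_eq_one y)
  by_contra h
  have hj' : J ≤ j := by simpa using hj
  have h1 := hθ.le_norm_of_ne_zero (hJ.trans hj') h
  have h2 : (2 : ℝ) ^ J ≤ 2 ^ j := pow_le_pow_right₀ (by norm_num) hj'
  linarith

/-- Only the five neighbouring members of the resolution meet the support of `θ j`. -/
theorem sum_mul_eq (hθ : IsDyadicResolution θ) (j : ℕ) (y : Eucl n) :
    ∑ k ∈ Finset.Icc (j - 2) (j + 2), θ j y * θ k y = θ j y := by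
  have h1 : HasSum (fun k => θ j y * θ k y) (θ j y * 1) := (hθ.sum_eq_one y).mul_left _
  rw [mul_one] at h1
  refine HasSum.unique (hasSum_sum_of_ne_finset_zero fun k hk => ?_) h1
  by_contra h
  obtain ⟨hj0, hk0⟩ := mul_ne_zero_iff.1 h
  have hcase : j + 3 ≤ k ∨ k + 3 ≤ j := by
    rw [Finset.mem_Icc] at hk; omega
  have hlt : ∀ a b : ℕ, a + 3 ≤ b → θ a y ≠ 0 → θ b y ≠ 0 → False := by
    intro a b hab ha hb
    have h2 := hθ.norm_le_of_ne_zero ha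
    have h3 := hθ.le_norm_of_ne_zero (by omega) hb
    have h4 : (2 : ℝ) ^ (a + 3) ≤ 2 ^ b := pow_le_pow_right₀ (by norm_num) hab
    have h5 : (0 : ℝ) < 2 ^ a := by positivity
    rw [pow_succ] at h2
    rw [pow_add] at h4
    linarith
  rcases hcase with h' | h'
  exacts [hlt _ _ h' hj0 hk0, hlt _ _ h' hk0 hj0]

theorem exists_symbol_bound (hθ : IsDyadicResolution θ) (l : ℕ) :
    ∃ B : ℝ, 1 ≤ B ∧ ∀ j, ∀ i ≤ l, ∀ x, ‖iteratedFDeriv ℝ i (symbol (θ j)) x‖ ≤ B := by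
  choose c hc hcb using hθ.bound
  have hpos : ∀ i, 0 ≤ (2 * Real.pi) ^ i * c i := fun i =>
    mul_nonneg (by positivity) (hc i).le
  refine ⟨1 + ∑ i ∈ Finset.range (l + 1), (2 * Real.pi) ^ i * c i,
    le_add_of_nonneg_right (Finset.sum_nonneg fun i _ => hpos i), fun j i hi x => ?_⟩
  rw [norm_iteratedFDeriv_symbol]
  have h1 : ‖iteratedFDeriv ℝ i (θ j) ((2 * Real.pi) • x)‖ ≤ c i :=
    (le_mul_of_one_le_left (norm_nonneg _) (one_le_pow₀ (by norm_num))).trans (hcb i j _)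
  calc _ ≤ (2 * Real.pi) ^ i * c i := by gcongr
    _ ≤ ∑ i ∈ Finset.range (l + 1), (2 * Real.pi) ^ i * c i :=
        Finset.single_le_sum (f := fun i => (2 * Real.pi) ^ i * c i) (fun i _ => hpos i)
          (Finset.mem_range.2 (by omega))
    _ ≤ _ := by linarith

theorem norm_two_pi_smul (ξ : Eucl n) : ‖(2 * Real.pi) • ξ‖ = 2 * Real.pi * ‖ξ‖ := by
  rw [norm_smul, Real.norm_of_nonneg (by positivity)]

/-- The dyadic pieces `θ_j(2π ·) u` of a Schwartz function decay rapidly in `j`. -/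
theorem exists_seminorm_symbol_mul_le (hθ : IsDyadicResolution θ) (k l M : ℕ) :
    ∃ C : ℝ, 0 ≤ C ∧ ∀ (j : ℕ) (u : 𝓢(Eucl n, ℂ)),
      (2 : ℝ) ^ (j * M) * SchwartzMap.seminorm ℂ k l (SchwartzMap.smulLeftCLM ℂ (symbol (θ j)) u) ≤
        C * (sumSeminorm k l u + sumSeminorm (k + M) l u) := by
  obtain ⟨B, hB1, hB⟩ := hθ.exists_symbol_bound l
  refine ⟨16 ^ M * (2 ^ l * B), by positivity, fun j u => ?_⟩
  have hS1 : 0 ≤ sumSeminorm k l u := apply_nonneg _ _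
  have hS2 : 0 ≤ sumSeminorm (k + M) l u := apply_nonneg _ _
  have hv : ∀ x, SchwartzMap.smulLeftCLM ℂ (symbol (θ j)) u x = symbol (θ j) x * u x := fun x =>
    SchwartzMap.smulLeftCLM_apply_apply (symbol (θ j)).hasTemperateGrowth u x
  rcases Nat.eq_zero_or_pos j with rfl | hj
  · have h := seminorm_mul_le ((symbol (θ 0)).smooth ⊤) hv (by positivity : 0 ≤ B) le_rfl (M := 0)
      (hB 0) (fun x hx => absurd hx (norm_nonneg x).not_gt) (k := k)
    simp only [pow_zero, one_mul, add_zero, zero_mul] at h ⊢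
    have h16 : (1 : ℝ) ≤ 16 ^ M := one_le_pow₀ (by norm_num)
    calc _ ≤ 1 * (2 ^ l * B) * sumSeminorm k l u := by rw [one_mul]; exact h
      _ ≤ 16 ^ M * (2 ^ l * B) * (sumSeminorm k l u + sumSeminorm (k + M) l u) := by
          gcongr; linarith
  · have h := seminorm_mul_le ((symbol (θ j)).smooth ⊤) hv (by positivity : 0 ≤ B)
      (R := 2 ^ j / 16) (by positivity) (M := M) (hB j) (fun x hx => ?_) (k := k)
    · calc (2 : ℝ) ^ (j * M) * SchwartzMap.seminorm ℂ k l
            (SchwartzMap.smulLeftCLM ℂ (symbol (θ j)) u)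
          = 16 ^ M * ((2 ^ j / 16) ^ M * SchwartzMap.seminorm ℂ k l
            (SchwartzMap.smulLeftCLM ℂ (symbol (θ j)) u)) := by
            rw [div_pow, ← pow_mul]; field_simp
        _ ≤ 16 ^ M * (2 ^ l * B * sumSeminorm (k + M) l u) := by gcongr
        _ ≤ 16 ^ M * (2 ^ l * B * (sumSeminorm k l u + sumSeminorm (k + M) l u)) := by
            gcongr; linarith
        _ = _ := by ring
    · by_contra hne
      have h1 := hθ.le_norm_of_ne_zero hj hne
      change 2 ^ j ≤ 2 * ‖(2 * Real.pi) • x‖ at h1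
      rw [norm_two_pi_smul] at h1
      have h2 : Real.pi * ‖x‖ ≤ 4 * ‖x‖ := by gcongr; exact Real.pi_le_four
      have h3 : (0 : ℝ) < 2 ^ j := by positivity
      nlinarith

/-- The partial sums of the resolution of unity, applied to a Schwartz function, converge in the
Schwartz space. -/
theorem tendsto_sum_smulLeft (hθ : IsDyadicResolution θ) (u : 𝓢(Eucl n, ℂ)) :
    Tendsto (fun J => ∑ j ∈ Finset.range J, SchwartzMap.smulLeftCLM ℂ (symbol (θ j)) u) atTop
      (𝓝 u) := by
  rw [(schwartz_withSeminorms ℂ (Eucl n) ℂ).tendsto_nhds]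
  rintro ⟨k, l⟩ ε hε
  simp only [SchwartzMap.schwartzSeminormFamily_apply]
  obtain ⟨B, hB1, hB⟩ := hθ.exists_symbol_bound l
  -- the multiplier of the remainder is `1 - ∑ θ_j`, with derivatives of size `O(J)`,
  -- and it vanishes for `|x| < 2 ^ J / 16`
  have key : ∀ J : ℕ, 1 ≤ J → SchwartzMap.seminorm ℂ k l
      (∑ j ∈ Finset.range J, SchwartzMap.smulLeftCLM ℂ (symbol (θ j)) u - u) ≤
      16 * (2 ^ l * B * sumSeminorm (k + 1) l u) * ((1 + J) / 2 ^ J) := by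
    intro J hJ
    set m : Eucl n → ℂ := fun x => (∑ j ∈ Finset.range J, symbol (θ j) x) - 1 with hm
    have hsm : ContDiff ℝ (⊤ : ℕ∞) (fun x => ∑ j ∈ Finset.range J, symbol (θ j) x) :=
      ContDiff.sum fun j _ => (symbol (θ j)).smooth ⊤
    have h := seminorm_mul_le (m := m) (u := u) (k := k) (l := l) (M := 1)
      (v := ∑ j ∈ Finset.range J, SchwartzMap.smulLeftCLM ℂ (symbol (θ j)) u - u)
      (B := (1 + J) * B) (R := 2 ^ J / 16) (hsm.sub contDiff_const) (fun x => ?_)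
      (by positivity) (by positivity) (fun i hi x => ?_) (fun x hx => ?_)
    · rw [pow_one, div_mul_eq_mul_div, div_le_iff₀ (by norm_num)] at h
      rw [← mul_div_assoc, le_div_iff₀ (by positivity)]
      linarith
    · rw [hm, sub_apply, sum_apply, sub_mul, Finset.sum_mul, one_mul]
      congr 1
      exact Finset.sum_congr rfl fun j _ =>
        SchwartzMap.smulLeftCLM_apply_apply (symbol (θ j)).hasTemperateGrowth u x
    · have hil : (i : WithTop ℕ∞) ≤ ((⊤ : ℕ∞) : WithTop ℕ∞) := by exact_mod_cast le_top
      have h1 : iteratedFDeriv ℝ i m x = (∑ j ∈ Finset.range J,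
          iteratedFDeriv ℝ i (symbol (θ j)) x) - iteratedFDeriv ℝ i (fun _ => (1 : ℂ)) x := by
        rw [hm]
        have := iteratedFDeriv_sub_apply (x := x) (hsm.of_le hil).contDiffAt
          (contDiff_const (c := (1 : ℂ))).contDiffAt
        rw [← iteratedFDeriv_fun_sum_apply
          fun j _ => (((symbol (θ j)).smooth ⊤).of_le hil).contDiffAt]
        exact this
      have h2 : ‖iteratedFDeriv ℝ i (fun _ : Eucl n => (1 : ℂ)) x‖ ≤ 1 := by
        rcases Nat.eq_zero_or_pos i with rfl | hi0
        · simp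
        · rw [iteratedFDeriv_const_of_ne hi0.ne']; simp
      rw [h1]
      calc _ ≤ ‖∑ j ∈ Finset.range J, iteratedFDeriv ℝ i (symbol (θ j)) x‖ +
            ‖iteratedFDeriv ℝ i (fun _ : Eucl n => (1 : ℂ)) x‖ := norm_sub_le _ _
        _ ≤ (∑ j ∈ Finset.range J, B) + 1 := by
            gcongr
            exact norm_sum_le_of_le _ fun j _ => hB j i hi x
        _ ≤ _ := by simp; linarith
    · rw [hm]
      simp only [symbol_apply]
      rw [hθ.sum_range_eq_one hJ, sub_self]
      rw [norm_two_pi_smul]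
      have h2 : Real.pi * ‖x‖ ≤ 4 * ‖x‖ := by gcongr; exact Real.pi_le_four
      linarith
  have hlim : Tendsto (fun J : ℕ => 16 * (2 ^ l * B * sumSeminorm (k + 1) l u) *
      ((1 + (J : ℝ)) / 2 ^ J)) atTop (𝓝 0) := by
    have h1 : Tendsto (fun J : ℕ => (J : ℝ) ^ 1 / (2 : ℝ) ^ J) atTop (𝓝 0) :=
      tendsto_pow_const_div_const_pow_of_one_lt 1 (by norm_num)
    have h2 : Tendsto (fun J : ℕ => (J : ℝ) ^ 0 / (2 : ℝ) ^ J) atTop (𝓝 0) :=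
      tendsto_pow_const_div_const_pow_of_one_lt 0 (by norm_num)
    have h3 := (h2.add h1).const_mul (16 * (2 ^ l * B * sumSeminorm (k + 1) l u))
    simpa [add_div] using h3
  filter_upwards [hlim.eventually_lt_const hε, eventually_ge_atTop 1] with J hJ hJ1
  exact (key J hJ1).trans_lt hJ

/-- Every tempered distribution is the sum of its dyadic pieces. -/
theorem tendsto_sum_multiplier (hθ : IsDyadicResolution θ) (f : 𝓢'(Eucl n, ℂ))
    (φ : 𝓢(Eucl n, ℂ)) :
    Tendsto (fun J => ∑ j ∈ Finset.range J, multiplier (θ j) f φ) atTop (𝓝 (f φ)) := by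
  have hF : Continuous fun u : 𝓢(Eucl n, ℂ) => f (𝓕 u) :=
    (map_continuous f).comp (fourierCLM ℂ 𝓢(Eucl n, ℂ)).continuous
  have h := (hF.tendsto _).comp (hθ.tendsto_sum_smulLeft (𝓕⁻ φ))
  rw [fourier_fourierInv_eq] at h
  refine h.congr fun J => ?_
  have h1 : 𝓕 (∑ j ∈ Finset.range J, SchwartzMap.smulLeftCLM ℂ (symbol (θ j)) (𝓕⁻ φ)) =
      ∑ j ∈ Finset.range J, block (θ j) φ :=
    map_sum (fourierCLM ℂ 𝓢(Eucl n, ℂ)) _ _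
  simp only [Function.comp_apply, h1, map_sum, multiplier_apply]

/-- Each dyadic piece reproduces under the neighbouring members of the resolution. -/
theorem multiplier_eq_sum (hθ : IsDyadicResolution θ) (f : 𝓢'(Eucl n, ℂ)) (j : ℕ)
    (φ : 𝓢(Eucl n, ℂ)) :
    multiplier (θ j) f φ =
      ∑ k ∈ Finset.Icc (j - 2) (j + 2), multiplier (θ j) f (block (θ k) φ) := by
  simp only [multiplier_apply]
  rw [← map_sum]
  congr 1
  have h1 : ∑ k ∈ Finset.Icc (j - 2) (j + 2), block (θ j) (block (θ k) φ) =
      𝓕 (∑ k ∈ Finset.Icc (j - 2) (j + 2),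
        SchwartzMap.smulLeftCLM ℂ (symbol (θ j)) (𝓕⁻ (block (θ k) φ))) :=
    (map_sum (fourierCLM ℂ 𝓢(Eucl n, ℂ)) _ _).symm
  rw [h1, block]
  congr 1
  ext x
  rw [sum_apply]
  simp only [fourierInv_block,
    SchwartzMap.smulLeftCLM_apply_apply (symbol _).hasTemperateGrowth, smul_eq_mul, symbol_apply]
  conv_lhs => rw [← hθ.sum_mul_eq j, Finset.sum_mul]
  exact Finset.sum_congr rfl fun k _ => mul_assoc _ _ _

end IsDyadicResolution

/-- The `L¹` norm is bounded by Schwartz seminorms. -/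
theorem exists_integral_norm_le : ∃ (N : ℕ) (C : ℝ), 0 ≤ C ∧ ∀ v : 𝓢(Eucl n, ℂ),
    ∫ x, ‖v x‖ ≤ C * (SchwartzMap.seminorm ℂ 0 0 v + SchwartzMap.seminorm ℂ N 0 v) := by
  have h0 : 0 ≤ ∫ x : Eucl n, (1 + ‖x‖) ^ (-((volume : Measure (Eucl n)).integrablePower : ℝ)) :=
    integral_nonneg fun x => by positivity
  refine ⟨(volume : Measure (Eucl n)).integrablePower,
    2 ^ (volume : Measure (Eucl n)).integrablePower *
      ∫ x : Eucl n, (1 + ‖x‖) ^ (-((volume : Measure (Eucl n)).integrablePower : ℝ)),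
    by positivity, fun v => ?_⟩
  have := SchwartzMap.integral_pow_mul_iteratedFDeriv_le ℂ (volume : Measure (Eucl n)) v 0 0
  simpa using this

/-- The `L¹` norms of the dyadic blocks of a test function decay faster than any power `2 ^ (-k M)`,
with a constant that depends continuously on the test function. -/
theorem IsDyadicResolution.exists_integral_block_le {θ : ℕ → 𝓢(Eucl n, ℂ)}
    (hθ : IsDyadicResolution θ) (M : ℕ) :
    ∃ P : 𝓢(Eucl n, ℂ) → ℝ, Continuous P ∧ P 0 = 0 ∧ ∀ (k : ℕ) (φ : 𝓢(Eucl n, ℂ)),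
      (2 : ℝ) ^ (k * M) * ∫ x, ‖block (θ k) φ x‖ ≤ P φ := by
  obtain ⟨N, C, hC, hL⟩ := exists_integral_norm_le (n := n)
  obtain ⟨s₁, C₁, hC₁, h₁⟩ := exists_seminorm_comp_le (fourierCLM ℂ 𝓢(Eucl n, ℂ)) 0 0
  obtain ⟨s₂, C₂, hC₂, h₂⟩ := exists_seminorm_comp_le (fourierCLM ℂ 𝓢(Eucl n, ℂ)) N 0
  choose D hD hDb using fun m : ℕ × ℕ => hθ.exists_seminorm_symbol_mul_le m.1 m.2 M
  set E : 𝓢(Eucl n, ℂ) → ℝ := fun u => ∑ m ∈ s₁ ∪ s₂,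
    D m * (sumSeminorm m.1 m.2 u + sumSeminorm (m.1 + M) m.2 u) with hE
  have hterm : ∀ m (u : 𝓢(Eucl n, ℂ)),
      0 ≤ D m * (sumSeminorm m.1 m.2 u + sumSeminorm (m.1 + M) m.2 u) := fun m u =>
    mul_nonneg (hD m) (add_nonneg (apply_nonneg _ _) (apply_nonneg _ _))
  have hE0 : ∀ u, 0 ≤ E u := fun u => Finset.sum_nonneg fun m _ => hterm m u
  have hEc : Continuous E := continuous_finsetSum _ fun m _ =>
    ((continuous_sumSeminorm _ _).add (continuous_sumSeminorm _ _)).const_mul _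
  refine ⟨fun φ => C * (C₁ + C₂) * E (𝓕⁻ φ),
    (hEc.comp (fourierInvCLM ℂ 𝓢(Eucl n, ℂ)).continuous).const_mul _, ?_, fun k φ => ?_⟩
  · have h0 : 𝓕⁻ (0 : 𝓢(Eucl n, ℂ)) = 0 := map_zero (fourierInvCLM ℂ 𝓢(Eucl n, ℂ))
    simp [hE, h0]
  have h2 : (0 : ℝ) < 2 ^ (k * M) := by positivity
  set w := SchwartzMap.smulLeftCLM ℂ (symbol (θ k)) (𝓕⁻ φ) with hw
  have ha : 0 ≤ E (𝓕⁻ φ) / 2 ^ (k * M) := div_nonneg (hE0 _) h2.le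
  have hsm : ∀ m ∈ s₁ ∪ s₂, SchwartzMap.seminorm ℂ m.1 m.2 w ≤ E (𝓕⁻ φ) / 2 ^ (k * M) := by
    intro m hm
    rw [le_div_iff₀ h2, mul_comm]
    exact (hDb m k (𝓕⁻ φ)).trans (Finset.single_le_sum (f := fun m => D m *
      (sumSeminorm m.1 m.2 (𝓕⁻ φ) + sumSeminorm (m.1 + M) m.2 (𝓕⁻ φ))) (fun m _ => hterm m _) hm)
  have e₁ := h₁ w _ ha fun m hm => hsm m (Finset.mem_union_left _ hm)
  have e₂ := h₂ w _ ha fun m hm => hsm m (Finset.mem_union_right _ hm)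
  calc (2 : ℝ) ^ (k * M) * ∫ x, ‖block (θ k) φ x‖
      ≤ 2 ^ (k * M) * (C * (C₁ * (E (𝓕⁻ φ) / 2 ^ (k * M)) + C₂ * (E (𝓕⁻ φ) / 2 ^ (k * M)))) := by
        gcongr
        refine (hL _).trans ?_
        gcongr
        exacts [e₁, e₂]
    _ = _ := by field_simp

/-! ### Functions representing distributions -/

theorem Represents.locallyIntegrable {h : Eucl n → ℂ} {T : 𝓢'(Eucl n, ℂ)} (hT : Represents h T) :
    LocallyIntegrable h := by
  intro x
  let b : ContDiffBump x := ⟨1, 2, one_pos, one_lt_two⟩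
  let φ : 𝓢(Eucl n, ℂ) := HasCompactSupport.toSchwartzMap (f := fun y => ((b y : ℝ) : ℂ))
    (b.hasCompactSupport.comp_left (g := fun t : ℝ => (t : ℂ)) Complex.ofReal_zero)
    (Complex.ofRealCLM.contDiff.comp b.contDiff)
  refine ⟨Metric.ball x 1, Metric.ball_mem_nhds x one_pos, ?_⟩
  refine ((hT φ).1.integrableOn (s := Metric.ball x 1)).congr_fun (fun y hy => ?_)
    measurableSet_ball
  have hφ : φ y = ((b y : ℝ) : ℂ) := rfl
  have h1 : b y = 1 := b.one_of_mem_closedBall (Metric.ball_subset_closedBall hy)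
  simp [hφ, h1]

theorem Represents.aestronglyMeasurable {h : Eucl n → ℂ} {T : 𝓢'(Eucl n, ℂ)}
    (hT : Represents h T) : AEStronglyMeasurable h :=
  hT.locallyIntegrable.aestronglyMeasurable

theorem Represents.smul {h : Eucl n → ℂ} {T : 𝓢'(Eucl n, ℂ)} (hT : Represents h T) (c : ℂ) :
    Represents (fun x => c * h x) (c • T) := by
  intro φ
  have h1 : ∀ x, φ x * (c * h x) = c * (φ x * h x) := fun x => by ring
  simp_rw [h1]
  refine ⟨(hT φ).1.const_mul c, ?_⟩
  rw [integral_const_mul, ← (hT φ).2]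
  rfl

theorem Represents.add {h k : Eucl n → ℂ} {T U : 𝓢'(Eucl n, ℂ)} (hT : Represents h T)
    (hU : Represents k U) : Represents (fun x => h x + k x) (T + U) := by
  intro φ
  simp_rw [mul_add]
  refine ⟨(hT φ).1.add (hU φ).1, ?_⟩
  rw [integral_add (hT φ).1 (hU φ).1, ← (hT φ).2, ← (hU φ).2]
  rfl

/-! ### Reproducing formula for band-limited functions -/

/-- The pointwise product of Schwartz functions. -/
abbrev mulSchwartz (u v : 𝓢(Eucl n, ℂ)) : 𝓢(Eucl n, ℂ) :=
  SchwartzMap.pairing (ContinuousLinearMap.mul ℂ ℂ) u v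

/-- The convolution of Schwartz functions. -/
abbrev convSchwartz (u v : 𝓢(Eucl n, ℂ)) : 𝓢(Eucl n, ℂ) :=
  SchwartzMap.convolution (ContinuousLinearMap.mul ℂ ℂ) u v

theorem convSchwartz_apply (u v : 𝓢(Eucl n, ℂ)) (x : Eucl n) :
    convSchwartz u v x = ∫ t, u t * v (x - t) :=
  SchwartzMap.convolution_apply (ContinuousLinearMap.mul ℂ ℂ) u v x

theorem fourierInv_mulSchwartz (b v : 𝓢(Eucl n, ℂ)) :
    𝓕⁻ (mulSchwartz (𝓕 b) v) = convSchwartz b (𝓕⁻ v) := by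
  have h := SchwartzMap.fourier_convolution (ContinuousLinearMap.mul ℂ ℂ) b (𝓕⁻ v)
  rw [fourier_fourierInv_eq] at h
  rw [mulSchwartz, ← h, fourierInv_fourier_eq]

theorem fourierInv_apply_neg (u : 𝓢(Eucl n, ℂ)) (ξ : Eucl n) : 𝓕⁻ u ξ = 𝓕 u (-ξ) := by
  rw [SchwartzMap.fourierInv_coe, SchwartzMap.fourier_coe]
  exact Real.fourierInv_eq_fourier_neg _ _

theorem fourierInv_convSchwartz_fourier (χ φ : 𝓢(Eucl n, ℂ)) (ξ : Eucl n) :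
    𝓕⁻ (convSchwartz (𝓕 χ) φ) ξ = χ ξ * 𝓕⁻ φ ξ := by
  have h := SchwartzMap.fourier_convolution (ContinuousLinearMap.mul ℂ ℂ) (𝓕 χ) φ
  rw [fourierInv_apply_neg, h, SchwartzMap.pairing_apply_apply, ContinuousLinearMap.mul_apply',
    ← fourierInv_apply_neg, ← fourierInv_apply_neg, fourierInv_fourier_eq]

/-- The sum of the first `j + 4` symbols. It equals one near the support of the `j`-th symbol, so it
is the multiplier under which `θ_j(D) f` reproduces itself. -/
def cutoff (θ : ℕ → 𝓢(Eucl n, ℂ)) (j : ℕ) : 𝓢(Eucl n, ℂ) :=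
  ∑ k ∈ Finset.range (j + 4), symbol (θ k)

theorem cutoff_eq_one {θ : ℕ → 𝓢(Eucl n, ℂ)} (hθ : IsDyadicResolution θ) {j : ℕ} {ξ ζ : Eucl n}
    (hξ : symbol (θ j) ξ ≠ 0) (hζ : 2 * Real.pi * ‖ζ‖ ≤ 1) : cutoff θ j (ξ - ζ) = 1 := by
  have h1 := hθ.norm_le_of_ne_zero hξ
  change ‖(2 * Real.pi) • ξ‖ ≤ _ at h1
  rw [cutoff, sum_apply]
  simp only [symbol_apply]
  refine hθ.sum_range_eq_one (by omega) ?_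
  rw [smul_sub]
  have h2 := norm_sub_le ((2 * Real.pi) • ξ) ((2 * Real.pi) • ζ)
  rw [IsDyadicResolution.norm_two_pi_smul ζ] at h2
  have h3 : (1 : ℝ) ≤ 2 ^ j := one_le_pow₀ (by norm_num)
  rw [pow_succ] at h1
  rw [pow_add]
  linarith

/-- Multiplication by `𝓕 b` enlarges the spectrum by the support of `b`, so that the convolution
with `𝓕 (cutoff θ j)` still acts as the identity. -/
theorem multiplier_mul_conv {θ : ℕ → 𝓢(Eucl n, ℂ)} (hθ : IsDyadicResolution θ) (j : ℕ)
    {b : 𝓢(Eucl n, ℂ)} (hb : ∀ ζ, b ζ ≠ 0 → 2 * Real.pi * ‖ζ‖ ≤ 1) (f : 𝓢'(Eucl n, ℂ))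
    (φ : 𝓢(Eucl n, ℂ)) :
    multiplier (θ j) f (mulSchwartz (𝓕 b) (convSchwartz (𝓕 (cutoff θ j)) φ)) =
      multiplier (θ j) f (mulSchwartz (𝓕 b) φ) := by
  rw [multiplier_apply, multiplier_apply]
  congr 1
  rw [block, block]
  congr 1
  ext ξ
  rw [SchwartzMap.smulLeftCLM_apply_apply (symbol _).hasTemperateGrowth,
    SchwartzMap.smulLeftCLM_apply_apply (symbol _).hasTemperateGrowth]
  rcases eq_or_ne (symbol (θ j) ξ) 0 with h0 | h0
  · rw [h0, zero_smul, zero_smul]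
  congr 1
  rw [fourierInv_mulSchwartz, fourierInv_mulSchwartz, convSchwartz_apply, convSchwartz_apply]
  congr 1
  ext t
  rcases eq_or_ne (b t) 0 with ht | ht
  · rw [ht, zero_mul, zero_mul]
  · rw [fourierInv_convSchwartz_fourier, cutoff_eq_one hθ h0 (hb t ht), one_mul]

/-- If `h` represents `θ_j(D) f`, then `𝓕 b · h` is reproduced by convolution with
`𝓕⁻¹ (cutoff θ j)`. The factor `𝓕 b` makes the function integrable: `h` itself is only known to
define a tempered distribution. -/
theorem Represents.ae_eq_conv {θ : ℕ → 𝓢(Eucl n, ℂ)} (hθ : IsDyadicResolution θ) {j : ℕ}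
    {b : 𝓢(Eucl n, ℂ)} (hb : ∀ ζ, b ζ ≠ 0 → 2 * Real.pi * ‖ζ‖ ≤ 1) {f : 𝓢'(Eucl n, ℂ)}
    {h : Eucl n → ℂ} (hf : Represents h (multiplier (θ j) f)) :
    ∀ᵐ x, 𝓕 b x * h x = ∫ y, 𝓕 b y * h y * 𝓕⁻ (cutoff θ j) (x - y) := by
  set H : Eucl n → ℂ := fun x => 𝓕 b x * h x with hH
  have hHi : Integrable H := (hf (𝓕 b)).1
  set κ := 𝓕⁻ (cutoff θ j) with hκ
  have hconv : Integrable (fun x => ∫ y, H y * κ (x - y)) :=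
    hHi.integrable_convolution (ContinuousLinearMap.mul ℂ ℂ) κ.integrable
  refine ae_eq_of_integral_contDiff_smul_eq hHi.locallyIntegrable hconv.locallyIntegrable ?_
  intro g hg hgc
  let φ : 𝓢(Eucl n, ℂ) := HasCompactSupport.toSchwartzMap (f := fun y => ((g y : ℝ) : ℂ))
    (hgc.comp_left (g := fun t : ℝ => (t : ℂ)) Complex.ofReal_zero)
    (Complex.ofRealCLM.contDiff.comp hg)
  have hφ : ∀ y, φ y = ((g y : ℝ) : ℂ) := fun _ => rfl
  have h1 := multiplier_mul_conv hθ j hb f φ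
  rw [(hf _).2, (hf _).2] at h1
  simp only [SchwartzMap.pairing_apply_apply, ContinuousLinearMap.mul_apply'] at h1
  have h2 : ∀ y, convSchwartz (𝓕 (cutoff θ j)) φ y = ∫ x, φ x * κ (x - y) := by
    intro y
    rw [convSchwartz_apply, ← integral_sub_left_eq_self _ volume y]
    congr 1
    ext x
    rw [sub_sub_cancel, hκ, fourierInv_apply_neg, neg_sub, mul_comm]
  calc ∫ x, g x • H x = ∫ x, 𝓕 b x * φ x * h x := by
        congr 1; ext x
        rw [hφ, hH, Complex.real_smul]; ring
    _ = ∫ y, ∫ x, φ x * (H y * κ (x - y)) := by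
        rw [← h1]
        congr 1; ext y
        rw [h2, mul_right_comm, ← integral_const_mul]
        congr 1; ext x
        rw [hH]; ring
    _ = ∫ x, ∫ y, φ x * (H y * κ (x - y)) := by
        refine integral_integral_swap ?_
        have hi : Integrable (fun z : Eucl n × Eucl n => H z.1 * φ z.2)
            (volume.prod volume) := hHi.mul_prod φ.integrable
        have hb : Integrable (fun z : Eucl n × Eucl n => κ (z.2 - z.1) * (H z.1 * φ z.2))
            (volume.prod volume) :=
          hi.bdd_mul (c := SchwartzMap.seminorm ℂ 0 0 κ)
            (κ.continuous.comp (continuous_snd.sub continuous_fst)).aestronglyMeasurable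
            (Eventually.of_forall fun z => SchwartzMap.norm_le_seminorm ℂ κ _)
        refine hb.congr (Eventually.of_forall fun z => ?_)
        simp only [Function.uncurry]
        ring
    _ = _ := by
        congr 1; ext x
        rw [integral_const_mul, hφ, Complex.real_smul]

/-! ### Sup bounds for band-limited functions -/

theorem tsupport_symbol_subset {θ : ℕ → 𝓢(Eucl n, ℂ)} (hθ : IsDyadicResolution θ) (j : ℕ) :
    tsupport (symbol (θ j)) ⊆ {x | ‖x‖ ≤ 2 ^ (j + 1)} := by
  refine closure_minimal (fun x hx => ?_) (isClosed_le continuous_norm continuous_const)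
  have h1 := hθ.norm_le_of_ne_zero (j := j) (y := (2 * Real.pi) • x) hx
  rw [IsDyadicResolution.norm_two_pi_smul] at h1
  have h2 : 1 * ‖x‖ ≤ 2 * Real.pi * ‖x‖ := by
    gcongr
    linarith [Real.two_le_pi]
  exact (one_mul ‖x‖ ▸ h2).trans h1

/-- Schwartz seminorms of the cutoffs grow at most exponentially in `j`: the `j`-th one has `j + 4`
uniformly smooth terms, all supported in a ball of radius `2 ^ (j + 4)`. -/
theorem exists_seminorm_cutoff_le {θ : ℕ → 𝓢(Eucl n, ℂ)} (hθ : IsDyadicResolution θ)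
    (s : Finset (ℕ × ℕ)) :
    ∃ (C : ℝ) (M : ℕ), 0 ≤ C ∧ ∀ j : ℕ, ∀ m ∈ s,
      SchwartzMap.seminorm ℂ m.1 m.2 (cutoff θ j) ≤ C * 2 ^ (j * M) := by
  have key : ∀ m : ℕ × ℕ, ∃ (C : ℝ) (M : ℕ), 0 ≤ C ∧ ∀ j : ℕ,
      SchwartzMap.seminorm ℂ m.1 m.2 (cutoff θ j) ≤ C * 2 ^ (j * M) := by
    rintro ⟨k, l⟩
    obtain ⟨B, hB1, hB⟩ := hθ.exists_symbol_bound l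
    refine ⟨2 ^ (4 * (k + 1)) * B, k + 1, by positivity, fun j => ?_⟩
    have hterm : ∀ i ∈ Finset.range (j + 4),
        SchwartzMap.seminorm ℂ k l (symbol (θ i)) ≤ (2 ^ (j + 4)) ^ k * B := by
      intro i hi
      refine SchwartzMap.seminorm_le_bound ℂ _ _ _ (by positivity) fun x => ?_
      by_cases hx : iteratedFDeriv ℝ l (symbol (θ i)) x = 0
      · rw [hx, norm_zero, mul_zero]; positivity
      · have h1 : ‖x‖ ≤ 2 ^ (i + 1) :=
          tsupport_symbol_subset hθ i (support_iteratedFDeriv_subset l hx)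
        have h2 : ‖x‖ ≤ 2 ^ (j + 4) := h1.trans
          (pow_le_pow_right₀ (by norm_num) (by have := Finset.mem_range.1 hi; omega))
        gcongr
        exact hB i l le_rfl x
    calc SchwartzMap.seminorm ℂ k l (cutoff θ j)
        ≤ ∑ i ∈ Finset.range (j + 4), SchwartzMap.seminorm ℂ k l (symbol (θ i)) := by
          rw [cutoff]
          exact Finset.le_sum_of_subadditive (SchwartzMap.seminorm ℂ k l) (map_zero _).le
            (map_add_le_add _) _ _
      _ ≤ ∑ i ∈ Finset.range (j + 4), (2 ^ (j + 4)) ^ k * B := Finset.sum_le_sum hterm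
      _ = ((j + 4 : ℕ) : ℝ) * ((2 ^ (j + 4)) ^ k * B) := by simp
      _ ≤ 2 ^ (j + 4) * ((2 ^ (j + 4)) ^ k * B) := by
          gcongr
          exact_mod_cast (Nat.lt_two_pow_self (n := j + 4)).le
      _ = 2 ^ (4 * (k + 1)) * 2 ^ (j * (k + 1)) * B := by
          rw [← pow_add, ← add_mul, ← mul_assoc, ← pow_succ', ← pow_mul, add_comm 4 j]
      _ = _ := by ring
  choose C M hC hCM using key
  refine ⟨∑ m ∈ s, C m, ∑ m ∈ s, M m, Finset.sum_nonneg fun m _ => hC m, fun j m hm => ?_⟩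
  refine (hCM m j).trans ?_
  have h1 : C m ≤ ∑ m ∈ s, C m := Finset.single_le_sum (fun m _ => hC m) hm
  have h2 : M m ≤ ∑ m ∈ s, M m := Finset.single_le_sum (fun m _ => Nat.zero_le _) hm
  have h3 : (2 : ℝ) ^ (j * M m) ≤ 2 ^ (j * ∑ m ∈ s, M m) :=
    pow_le_pow_right₀ (by norm_num) (Nat.mul_le_mul_left j h2)
  exact mul_le_mul h1 h3 (by positivity) (Finset.sum_nonneg fun m _ => hC m)

/-- The reproducing kernels grow at most exponentially in `j`, both in `L¹` and in `L^∞`. -/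
theorem exists_kernel_bound {θ : ℕ → 𝓢(Eucl n, ℂ)} (hθ : IsDyadicResolution θ) :
    ∃ (C : ℝ) (M : ℕ), 1 ≤ C ∧ ∀ j : ℕ,
      ∫ x, ‖𝓕⁻ (cutoff θ j) x‖ ≤ C * 2 ^ (j * M) ∧ ∀ x, ‖𝓕⁻ (cutoff θ j) x‖ ≤ C * 2 ^ (j * M) := by
  obtain ⟨N, L, hL, hLb⟩ := exists_integral_norm_le (n := n)
  obtain ⟨s₁, C₁, hC₁, h₁⟩ := exists_seminorm_comp_le (fourierInvCLM ℂ 𝓢(Eucl n, ℂ)) 0 0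
  obtain ⟨s₂, C₂, hC₂, h₂⟩ := exists_seminorm_comp_le (fourierInvCLM ℂ 𝓢(Eucl n, ℂ)) N 0
  obtain ⟨D, M, hD, hDb⟩ := exists_seminorm_cutoff_le hθ (s₁ ∪ s₂)
  refine ⟨1 + L * (C₁ * D + C₂ * D) + C₁ * D, M, ?_, fun j => ?_⟩
  · have : 0 ≤ L * (C₁ * D + C₂ * D) + C₁ * D := by positivity
    linarith
  have ha : 0 ≤ D * 2 ^ (j * M) := by positivity
  have e₁ : SchwartzMap.seminorm ℂ 0 0 (𝓕⁻ (cutoff θ j)) ≤ _ :=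
    h₁ (cutoff θ j) _ ha fun m hm => hDb j m (Finset.mem_union_left _ hm)
  have e₂ : SchwartzMap.seminorm ℂ N 0 (𝓕⁻ (cutoff θ j)) ≤ _ :=
    h₂ (cutoff θ j) _ ha fun m hm => hDb j m (Finset.mem_union_right _ hm)
  have h2 : (0 : ℝ) < 2 ^ (j * M) := by positivity
  have p1 : 0 ≤ L * (C₁ * D + C₂ * D) * 2 ^ (j * M) := by positivity
  have p2 : 0 ≤ C₁ * D * 2 ^ (j * M) := by positivity
  constructor
  · calc _ ≤ L * (C₁ * (D * 2 ^ (j * M)) + C₂ * (D * 2 ^ (j * M))) := by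
          refine (hLb _).trans ?_
          gcongr
      _ = L * (C₁ * D + C₂ * D) * 2 ^ (j * M) := by ring
      _ ≤ _ := by linarith
  · intro x
    calc _ ≤ C₁ * (D * 2 ^ (j * M)) := (SchwartzMap.norm_le_seminorm ℂ _ x).trans e₁
      _ ≤ _ := by linarith

/-- There are band-limited functions `𝓕 b`, bounded by one, tending to one pointwise. -/
theorem exists_bandlimited_tendsto_one : ∃ b : ℕ → 𝓢(Eucl n, ℂ),
    (∀ i ζ, b i ζ ≠ 0 → 2 * Real.pi * ‖ζ‖ ≤ 1) ∧ (∀ i x, ‖𝓕 (b i) x‖ ≤ 1) ∧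
      ∀ x, Tendsto (fun i => 𝓕 (b i) x) atTop (𝓝 1) := by
  have hpos : ∀ i : ℕ, (0 : ℝ) < 1 / (i + 8) := fun i => by positivity
  let B : ℕ → ContDiffBump (0 : Eucl n) := fun i =>
    ⟨1 / (i + 8) / 2, 1 / (i + 8), half_pos (hpos i), half_lt_self (hpos i)⟩
  have hBr : ∀ i, (B i).rOut = 1 / (i + 8) := fun _ => rfl
  let b : ℕ → 𝓢(Eucl n, ℂ) := fun i =>
    HasCompactSupport.toSchwartzMap (f := fun y => (((B i).normed volume y : ℝ) : ℂ))
      ((B i).hasCompactSupport_normed.comp_left (g := fun t : ℝ => (t : ℂ)) Complex.ofReal_zero)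
      (Complex.ofRealCLM.contDiff.comp (B i).contDiff_normed)
  have hb : ∀ i y, b i y = (((B i).normed volume y : ℝ) : ℂ) := fun _ _ => rfl
  refine ⟨b, fun i ζ hζ => ?_, fun i x => ?_, fun x => ?_⟩
  · have h1 : ζ ∈ Function.support ((B i).normed volume) := by
      rw [hb] at hζ
      exact fun h => hζ (by rw [h]; simp)
    rw [ContDiffBump.support_normed_eq, mem_ball_zero_iff, hBr] at h1
    have h2 : (1 : ℝ) / (i + 8) ≤ 1 / 8 := by
      gcongr; linarith [(Nat.cast_nonneg i : (0 : ℝ) ≤ i)]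
    nlinarith [Real.pi_le_four, Real.pi_pos, norm_nonneg ζ]
  · rw [SchwartzMap.fourier_coe]
    refine (VectorFourier.norm_fourierIntegral_le_integral_norm _ _ _ _ _).trans ?_
    simp_rw [hb, Complex.norm_real, Real.norm_of_nonneg ((B i).nonneg_normed _)]
    exact (B i).integral_normed.le
  · have hcont : Continuous fun w : Eucl n => (Real.fourierChar (inner ℝ w x) : ℂ) := by
      fun_prop
    have hr : Tendsto (fun i => (B i).rOut) atTop (𝓝 0) := by
      simp_rw [hBr, one_div]
      refine Tendsto.inv_tendsto_atTop ?_
      exact tendsto_atTop_add_const_right _ _ tendsto_natCast_atTop_atTop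
    have h := ContDiffBump.convolution_tendsto_right_of_continuous (μ := volume) hr hcont 0
    simp only [inner_zero_left, AddChar.map_zero_eq_one, Circle.coe_one] at h
    refine h.congr fun i => ?_
    rw [SchwartzMap.fourier_coe, Real.fourier_eq, convolution_def]
    refine integral_congr_ae (Eventually.of_forall fun v => ?_)
    simp only [ContinuousLinearMap.lsmul_apply, zero_sub, inner_neg_left, hb, Circle.smul_def,
      Complex.real_smul, smul_eq_mul, mul_comm]

/-- The sup bound behind the embedding for exponents below one: if `H = H ⋆ κ` with `κ` bounded and
`H` integrable, then `H` is bounded, and the bound `K` satisfies `K ≤ K ^ (1 - r) * D` where `D`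
only involves `|H| ^ r`. -/
theorem ae_enorm_le_of_eq_conv {H κ : Eucl n → ℂ} (hH : Integrable H) {B : ℝ} (hκ : ∀ x, ‖κ x‖ ≤ B)
    (hconv : ∀ᵐ x, H x = ∫ y, H y * κ (x - y)) {r : ℝ} (hr : 0 < r) (hr1 : r ≤ 1) {D : ℝ≥0∞}
    (hD : ∀ x, ∫⁻ y, ‖H y‖ₑ ^ r * ‖κ (x - y)‖ₑ ≤ D) :
    ∀ᵐ x, ‖H x‖ₑ ≤ D ^ (1 / r) := by
  set K := essSup (fun x => ‖H x‖ₑ) volume with hK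
  have hle : ∀ᵐ x, ‖H x‖ₑ ≤ K := ENNReal.ae_le_essSup _
  have h1 : ∀ᵐ x, ‖H x‖ₑ ≤ ∫⁻ y, ‖H y‖ₑ * ‖κ (x - y)‖ₑ := by
    filter_upwards [hconv] with x hx
    rw [hx]
    refine (enorm_integral_le_lintegral_enorm _).trans_eq ?_
    simp_rw [enorm_mul]
  -- the a priori bound that allows division by `K ^ (1 - r)` below
  have hKtop : K ≠ ∞ := by
    refine ne_top_of_le_ne_top (ENNReal.mul_ne_top hH.2.ne (ENNReal.ofReal_ne_top (r := B)))
      (essSup_le_of_ae_le _ ?_)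
    filter_upwards [h1] with x hx
    refine hx.trans ?_
    rw [← lintegral_mul_const' _ _ ENNReal.ofReal_ne_top]
    refine lintegral_mono fun y => ?_
    gcongr
    rw [← ofReal_norm]
    exact ENNReal.ofReal_le_ofReal (hκ _)
  have h2 : K ≤ K ^ (1 - r) * D := by
    refine essSup_le_of_ae_le _ ?_
    filter_upwards [h1] with x hx
    refine hx.trans ?_
    calc ∫⁻ y, ‖H y‖ₑ * ‖κ (x - y)‖ₑ
        ≤ ∫⁻ y, K ^ (1 - r) * (‖H y‖ₑ ^ r * ‖κ (x - y)‖ₑ) := by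
          refine lintegral_mono_ae ?_
          filter_upwards [hle] with y hy
          rw [← mul_assoc]
          gcongr
          calc ‖H y‖ₑ = ‖H y‖ₑ ^ (1 - r) * ‖H y‖ₑ ^ r := by
                rw [← ENNReal.rpow_add_of_nonneg _ _ (by linarith) hr.le, sub_add_cancel,
                  ENNReal.rpow_one]
            _ ≤ _ := by gcongr
      _ = K ^ (1 - r) * ∫⁻ y, ‖H y‖ₑ ^ r * ‖κ (x - y)‖ₑ :=
          lintegral_const_mul' _ _ (ENNReal.rpow_ne_top_of_nonneg (by linarith) hKtop)
      _ ≤ _ := by gcongr; exact hD x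
  have h3 : K ≤ D ^ (1 / r) := by
    rcases eq_or_ne K 0 with h0 | h0
    · rw [h0]; exact bot_le
    have h4 : K ^ (1 - r) * K ^ r ≤ K ^ (1 - r) * D := by
      rwa [← ENNReal.rpow_add_of_nonneg _ _ (by linarith) hr.le, sub_add_cancel, ENNReal.rpow_one]
    have h5 : K ^ r ≤ D := by
      refine (ENNReal.mul_le_mul_iff_right ?_ ?_).1 h4
      · exact (ENNReal.rpow_pos (pos_iff_ne_zero.2 h0) hKtop).ne'
      · exact ENNReal.rpow_ne_top_of_nonneg (by linarith) hKtop
    rw [one_div]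
    exact (ENNReal.le_rpow_inv_iff hr).2 h5
  filter_upwards [hle] with x hx using hx.trans h3

theorem rpow_le_one_add_rpow {r p : ℝ} (hr : 0 < r) (hrp : r ≤ p) (u : ℝ≥0∞) :
    u ^ r ≤ 1 + u ^ p := by
  rcases le_total u 1 with h | h
  · exact (ENNReal.rpow_le_one h hr.le).trans le_self_add
  · exact (ENNReal.rpow_le_rpow_of_exponent_le h hrp).trans le_add_self

theorem enorm_two_rpow (t : ℝ) : ‖(((2 : ℝ) ^ t : ℝ) : ℂ)‖ₑ = ENNReal.ofReal (2 ^ t) := by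
  rw [← ofReal_norm, Complex.norm_real, Real.norm_of_nonneg (by positivity)]

/-- A band-limited function whose weighted modular is at most one is bounded by a constant that
grows at most exponentially with the frequency scale `j`. -/
theorem IsDyadicResolution.exists_sup_bound {θ : ℕ → 𝓢(Eucl n, ℂ)} (hθ : IsDyadicResolution θ)
    {p s : Eucl n → ℝ} {r : ℝ} (hr : 0 < r) (hr1 : r ≤ 1)
    (hrp : ∀ᵐ x ∂(volume : Measure (Eucl n)), r ≤ p x) {S : ℕ} (hS : ∀ x, |s x| ≤ S) :
    ∃ (C : ℝ) (M : ℕ), 0 ≤ C ∧ ∀ (j : ℕ) (f : 𝓢'(Eucl n, ℂ)) (h : ℕ → Eucl n → ℂ),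
      Represents (h j) (multiplier (θ j) f) → ∫⁻ x, ‖weighted s h j x‖ₑ ^ p x ≤ 1 →
      ∀ᵐ x, ‖h j x‖ ≤ C * 2 ^ (j * M) := by
  obtain ⟨C, M, hC1, hCM⟩ := exists_kernel_bound hθ
  obtain ⟨b, hb, hb1, hblim⟩ := exists_bandlimited_tendsto_one (n := n)
  refine ⟨(2 * C) ^ ⌈1 / r⌉₊, (M + S) * ⌈1 / r⌉₊, by positivity, fun j f h hh hmod => ?_⟩
  set κ := 𝓕⁻ (cutoff θ j) with hκ
  set E : ℝ := C * 2 ^ (j * M) with hE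
  have hE0 : 0 ≤ E := by positivity
  obtain ⟨hκ1, hκs⟩ := hCM j
  have hκ1' : ∫⁻ x, ‖κ x‖ₑ ≤ ENNReal.ofReal E := by
    rw [← ofReal_integral_norm_eq_lintegral_enorm κ.integrable]
    exact ENNReal.ofReal_le_ofReal hκ1
  have hκs' : ∀ x, ‖κ x‖ₑ ≤ ENNReal.ofReal E := fun x => by
    rw [← ofReal_norm]; exact ENNReal.ofReal_le_ofReal (hκs x)
  -- pointwise bound of `|h|^r` by the weighted modular
  have hpt : ∀ᵐ y, ‖h j y‖ₑ ^ r ≤ ENNReal.ofReal (2 ^ (j * S)) *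
      (1 + ‖weighted s h j y‖ₑ ^ p y) := by
    filter_upwards [hrp] with y hy
    have h1 : ‖h j y‖ₑ ≤ ENNReal.ofReal (2 ^ (j * S)) * ‖weighted s h j y‖ₑ := by
      rw [weighted, enorm_mul, enorm_two_rpow, ← mul_assoc, ← ENNReal.ofReal_mul (by positivity),
        ← Real.rpow_natCast, ← Real.rpow_add two_pos]
      refine le_mul_of_one_le_left bot_le ?_
      rw [ENNReal.one_le_ofReal]
      refine Real.one_le_rpow one_le_two ?_
      push_cast
      rw [← mul_add]
      have := neg_abs_le (s y)
      exact mul_nonneg (Nat.cast_nonneg _) (by linarith [hS y])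
    calc ‖h j y‖ₑ ^ r ≤ (ENNReal.ofReal (2 ^ (j * S)) * ‖weighted s h j y‖ₑ) ^ r := by gcongr
      _ = ENNReal.ofReal (2 ^ (j * S)) ^ r * ‖weighted s h j y‖ₑ ^ r :=
          ENNReal.mul_rpow_of_nonneg _ _ hr.le
      _ ≤ _ := by
          gcongr
          · refine (ENNReal.rpow_le_rpow_of_exponent_le ?_ hr1).trans_eq (ENNReal.rpow_one _)
            rw [ENNReal.one_le_ofReal]
            exact one_le_pow₀ one_le_two
          · exact rpow_le_one_add_rpow hr hy _
  set D : ℝ≥0∞ := ENNReal.ofReal (2 ^ (j * S)) * (ENNReal.ofReal E + ENNReal.ofReal E) with hD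
  have hDb : ∀ i x, ∫⁻ y, ‖𝓕 (b i) y * h j y‖ₑ ^ r * ‖κ (x - y)‖ₑ ≤ D := by
    intro i x
    calc ∫⁻ y, ‖𝓕 (b i) y * h j y‖ₑ ^ r * ‖κ (x - y)‖ₑ
        ≤ ∫⁻ y, ENNReal.ofReal (2 ^ (j * S)) *
            (‖κ (x - y)‖ₑ + ‖weighted s h j y‖ₑ ^ p y * ENNReal.ofReal E) := by
          refine lintegral_mono_ae ?_
          filter_upwards [hpt] with y hy
          have h1 : ‖𝓕 (b i) y * h j y‖ₑ ≤ ‖h j y‖ₑ := by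
            rw [enorm_mul]
            refine mul_le_of_le_one_left bot_le ?_
            rw [← ofReal_norm, ENNReal.ofReal_le_one]
            exact hb1 i y
          calc _ ≤ ENNReal.ofReal (2 ^ (j * S)) * (1 + ‖weighted s h j y‖ₑ ^ p y) *
                ‖κ (x - y)‖ₑ := by
                gcongr
                exact (ENNReal.rpow_le_rpow h1 hr.le).trans hy
            _ = ENNReal.ofReal (2 ^ (j * S)) * (‖κ (x - y)‖ₑ + ‖weighted s h j y‖ₑ ^ p y *
                ‖κ (x - y)‖ₑ) := by ring
            _ ≤ _ := by gcongr; exact hκs' _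
      _ = ENNReal.ofReal (2 ^ (j * S)) * ((∫⁻ y, ‖κ (x - y)‖ₑ) +
            (∫⁻ y, ‖weighted s h j y‖ₑ ^ p y) * ENNReal.ofReal E) := by
          rw [lintegral_const_mul' _ _ ENNReal.ofReal_ne_top, lintegral_add_left,
            lintegral_mul_const' _ _ ENNReal.ofReal_ne_top]
          exact (κ.continuous.comp (continuous_const.sub continuous_id)).measurable.enorm
      _ ≤ ENNReal.ofReal (2 ^ (j * S)) * (ENNReal.ofReal E + 1 * ENNReal.ofReal E) := by
          gcongr
          rw [lintegral_sub_left_eq_self (fun z => ‖κ z‖ₑ) x]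
          exact hκ1'
      _ = D := by rw [one_mul]
  have hDle : D ^ (1 / r) ≤
      ENNReal.ofReal ((2 * C) ^ ⌈1 / r⌉₊ * 2 ^ (j * ((M + S) * ⌈1 / r⌉₊))) := by
    have hDe : D = ENNReal.ofReal (2 * C * 2 ^ (j * (M + S))) := by
      rw [hD, ← ENNReal.ofReal_add hE0 hE0, ← ENNReal.ofReal_mul (by positivity)]
      congr 1
      rw [hE, mul_add j, pow_add]; ring
    have h1 : (1 : ℝ) ≤ 2 * C * 2 ^ (j * (M + S)) := by
      have : (1 : ℝ) ≤ 2 ^ (j * (M + S)) := one_le_pow₀ one_le_two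
      nlinarith
    have h2 : 2 * C * (2 : ℝ) ^ (j * (M + S)) ≥ 0 := by linarith
    calc D ^ (1 / r) ≤ D ^ ((⌈1 / r⌉₊ : ℕ) : ℝ) := by
          refine ENNReal.rpow_le_rpow_of_exponent_le ?_ (Nat.le_ceil _)
          rw [hDe, ENNReal.one_le_ofReal]; exact h1
      _ = _ := by
          rw [ENNReal.rpow_natCast, hDe, ← ENNReal.ofReal_pow h2, mul_pow, ← pow_mul, mul_assoc]
  -- the bound does not depend on `i`, so the integrability factor `𝓕 (b i)` may tend to one
  have hall : ∀ᵐ x, ∀ i, ‖𝓕 (b i) x * h j x‖ ≤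
      (2 * C) ^ ⌈1 / r⌉₊ * 2 ^ (j * ((M + S) * ⌈1 / r⌉₊)) := by
    refine ae_all_iff.2 fun i => ?_
    have h3 := ae_enorm_le_of_eq_conv (H := fun x => 𝓕 (b i) x * h j x) (hh (𝓕 (b i))).1 hκs
      (hh.ae_eq_conv hθ (hb i)) hr hr1 (hDb i)
    filter_upwards [h3] with x hx
    rw [← ENNReal.ofReal_le_ofReal_iff (by positivity), ofReal_norm]
    exact hx.trans hDle
  filter_upwards [hall] with x hx
  refine le_of_tendsto (f := fun i => ‖𝓕 (b i) x * h j x‖) (x := atTop) ?_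
    (Eventually.of_forall hx)
  simpa using ((hblim x).mul_const (h j x)).norm

/-! ### Log-Hölder continuous functions are bounded and continuous -/

theorem IsLogHolder.exists_abs_le {s : Eucl n → ℝ} (hs : IsLogHolder s) :
    ∃ S : ℕ, ∀ x, |s x| ≤ S := by
  obtain ⟨C, c, hC, h⟩ := hs.decay
  obtain ⟨S, hS⟩ := exists_nat_ge (C + |c|)
  refine ⟨S, fun x => le_trans ?_ hS⟩
  have h1 : 1 ≤ Real.log (Real.exp 1 + ‖x‖) := by
    rw [Real.le_log_iff_exp_le (by positivity)]
    linarith [norm_nonneg x]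
  have h2 : |s x - c| ≤ C := (h x).trans (div_le_self hC.le h1)
  have h3 := abs_add_le (s x - c) c
  rw [sub_add_cancel] at h3
  linarith

theorem IsLogHolder.continuous {s : Eucl n → ℝ} (hs : IsLogHolder s) : Continuous s := by
  obtain ⟨C, hC, h⟩ := hs.holder
  rw [continuous_iff_continuousAt]
  intro x
  rw [ContinuousAt, ← tendsto_sub_nhds_zero_iff, tendsto_zero_iff_abs_tendsto_zero]
  rw [← nhdsNE_sup_pure x, tendsto_sup]
  constructor
  · have h1 : Tendsto (fun y => ‖y - x‖) (𝓝[≠] x) (𝓝[>] 0) := by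
      refine tendsto_nhdsWithin_iff.2 ⟨?_, ?_⟩
      · have : Tendsto (fun y : Eucl n => ‖y - x‖) (𝓝 x) (𝓝 ‖x - x‖) :=
          ((continuous_id.sub continuous_const).norm).tendsto x
        rw [sub_self, norm_zero] at this
        exact this.mono_left nhdsWithin_le_nhds
      · filter_upwards [self_mem_nhdsWithin] with y hy
        exact norm_pos_iff.2 (sub_ne_zero.2 hy)
    have h2 : Tendsto (fun y => C / Real.log (Real.exp 1 + ‖y - x‖⁻¹)) (𝓝[≠] x) (𝓝 0) := by
      refine Tendsto.const_div_atTop (Real.tendsto_log_atTop.comp ?_) C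
      exact tendsto_atTop_add_const_left _ _ (tendsto_inv_nhdsGT_zero.comp h1)
    refine squeeze_zero' (Eventually.of_forall fun y => abs_nonneg _) ?_ h2
    filter_upwards [self_mem_nhdsWithin] with y hy
    exact h y x hy
  · simp only [Function.comp_def, tendsto_pure_left, sub_self, abs_zero]
    exact fun t ht => mem_of_mem_nhds ht

/-! ### The gauge of a modular on tempered distributions -/

/-- `a` is an admissible bound for the norm of `f`: some representatives `h j` of `θ_j(D) f` satisfy
`M (|2^{j s} h_j| / a) ≤ 1`. The norm of `f` is the infimum of all such `a`. -/
def Admissible (θ : ℕ → 𝓢(Eucl n, ℂ)) (M : (ℕ → Eucl n → ℝ≥0∞) → ℝ≥0∞) (s : Eucl n → ℝ)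
    (f : 𝓢'(Eucl n, ℂ)) (a : ℝ≥0∞) : Prop :=
  a ≠ 0 ∧ a ≠ ∞ ∧ ∃ h : ℕ → Eucl n → ℂ, (∀ j, Represents (h j) (multiplier (θ j) f)) ∧
    M (fun j x => ‖weighted s h j x‖ₑ / a) ≤ 1

theorem aestronglyMeasurable_weighted {s : Eucl n → ℝ} (hs : Continuous s)
    {h : ℕ → Eucl n → ℂ} (hh : ∀ j, AEStronglyMeasurable (h j)) (j : ℕ) :
    AEStronglyMeasurable (weighted s h j) := by
  refine AEStronglyMeasurable.mul (Continuous.aestronglyMeasurable ?_) (hh j)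
  refine Complex.continuous_ofReal.comp ?_
  exact continuous_const.rpow (continuous_const.mul hs) fun x => Or.inl two_ne_zero

theorem div_mul_div_eq {a c : ℝ≥0∞} (ha : a ≠ 0) (ha' : a ≠ ∞) (u : ℝ≥0∞) :
    a / c * (u / a) = u / c := by
  simp only [div_eq_mul_inv]
  calc a * c⁻¹ * (u * a⁻¹) = u * c⁻¹ * (a * a⁻¹) := by ring
    _ = _ := by rw [ENNReal.mul_inv_cancel ha ha', mul_one]

namespace IsSeqModular

variable {p : Eucl n → ℝ} {α : ℝ} {M : (ℕ → Eucl n → ℝ≥0∞) → ℝ≥0∞}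

/-- The `α`-triangle inequality for the gauge of a modular. -/
theorem add_div_le (hM : IsSeqModular p α M) (hα : 0 < α) {F G : ℕ → Eucl n → ℝ≥0∞}
    (hF : ∀ j, AEMeasurable (F j)) (hG : ∀ j, AEMeasurable (G j)) {a b c : ℝ≥0∞}
    (ha : a ≠ 0) (ha' : a ≠ ∞) (hb : b ≠ 0) (hb' : b ≠ ∞)
    (hc : a ^ α + b ^ α ≤ c ^ α) (h1 : M (fun j x => F j x / a) ≤ 1)
    (h2 : M (fun j x => G j x / b) ≤ 1) : M (fun j x => (F j x + G j x) / c) ≤ 1 := by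
  have h3 : (a / c) ^ α + (b / c) ^ α ≤ 1 := by
    rw [ENNReal.div_rpow_of_nonneg _ _ hα.le, ENNReal.div_rpow_of_nonneg _ _ hα.le,
      ENNReal.div_add_div_same]
    exact ENNReal.div_le_of_le_mul (by rwa [one_mul])
  have h4 := hM.convex _ _ (fun j => (hF j).div_const a) (fun j => (hG j).div_const b) _ _ h3 h1 h2
  simpa only [div_mul_div_eq ha ha', div_mul_div_eq hb hb', ENNReal.div_add_div_same] using h4

/-- The `α`-triangle inequality for finite sums. -/
theorem sum_div_le (hM : IsSeqModular p α M) (hα : 0 < α) {F : ℕ → ℕ → Eucl n → ℝ≥0∞}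
    (hF : ∀ k j, AEMeasurable (F k j)) {a : ℕ → ℝ≥0∞} (ha : ∀ k, a k ≠ 0) (ha' : ∀ k, a k ≠ ∞)
    (h : ∀ k, M (fun j x => F k j x / a k) ≤ 1) (L : ℕ) {b : ℝ≥0∞}
    (hb : ∑ k ∈ Finset.range (L + 1), a k ^ α ≤ b ^ α) :
    M (fun j x => (∑ k ∈ Finset.range (L + 1), F k j x) / b) ≤ 1 := by
  induction L generalizing b with
  | zero =>
    have hab : a 0 ≤ b := by simpa [ENNReal.rpow_le_rpow_iff hα] using hb
    refine (hM.mono _ _ fun j => Eventually.of_forall fun x => ?_).trans (h 0)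
    simp only [zero_add, Finset.range_one, Finset.sum_singleton]
    exact ENNReal.div_le_div_left hab _
  | succ L ih =>
    set c : ℝ≥0∞ := (∑ k ∈ Finset.range (L + 1), a k ^ α) ^ (1 / α) with hc
    have hcα : c ^ α = ∑ k ∈ Finset.range (L + 1), a k ^ α := by
      rw [hc, ← ENNReal.rpow_mul, one_div_mul_cancel hα.ne', ENNReal.rpow_one]
    have hsum : ∑ k ∈ Finset.range (L + 1), a k ^ α ≠ ∞ :=
      (ENNReal.sum_lt_top.2 fun k _ => ENNReal.rpow_lt_top_of_nonneg hα.le (ha' k)).ne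
    have hsum0 : ∑ k ∈ Finset.range (L + 1), a k ^ α ≠ 0 := by
      intro h0
      have := Finset.sum_eq_zero_iff.1 h0 0 (by simp)
      exact (ENNReal.rpow_pos (pos_iff_ne_zero.2 (ha 0)) (ha' 0)).ne' this
    simp_rw [Finset.sum_range_succ _ (L + 1)] at hb ⊢
    refine hM.add_div_le hα (fun j => Finset.aemeasurable_fun_sum _ fun k _ => hF k j)
      (fun j => hF (L + 1) j) (a := c) (b := a (L + 1)) ?_ ?_ (ha _) (ha' _) (by rwa [hcα])
      (ih hcα.ge) (h _)
    · exact (ENNReal.rpow_pos (pos_iff_ne_zero.2 hsum0) hsum).ne'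
    · exact ENNReal.rpow_ne_top_of_nonneg (by positivity) hsum

end IsSeqModular

section Gauge

variable {p s : Eucl n → ℝ} {α : ℝ} {M : (ℕ → Eucl n → ℝ≥0∞) → ℝ≥0∞} {θ : ℕ → 𝓢(Eucl n, ℂ)}

theorem Admissible.zero (hM : IsSeqModular p α M) {a : ℝ≥0∞} (ha : a ≠ 0) (ha' : a ≠ ∞) :
    Admissible θ M s 0 a := by
  refine ⟨ha, ha', fun _ _ => 0, fun j φ => ?_, ?_⟩
  · simp [multiplier]
  · simpa [weighted] using hM.zero

theorem Admissible.smul {f : 𝓢'(Eucl n, ℂ)} {a : ℝ≥0∞}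
    (hf : Admissible θ M s f a) {c : ℂ} (hc : c ≠ 0) : Admissible θ M s (c • f) (‖c‖ₑ * a) := by
  obtain ⟨ha, ha', h, hh, hmod⟩ := hf
  have hc0 : ‖c‖ₑ ≠ 0 := by simpa using hc
  refine ⟨mul_ne_zero hc0 ha, ENNReal.mul_ne_top enorm_ne_top ha', fun j x => c * h j x,
    fun j => ?_, ?_⟩
  · rw [multiplier_smul]; exact (hh j).smul c
  · have h1 : ∀ j x, ‖weighted s (fun j x => c * h j x) j x‖ₑ / (‖c‖ₑ * a) =
        ‖weighted s h j x‖ₑ / a := fun j x => by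
      have : weighted s (fun j x => c * h j x) j x = c * weighted s h j x := by
        simp only [weighted]; ring
      rw [this, enorm_mul]
      exact ENNReal.mul_div_mul_left _ _ hc0 enorm_ne_top
    simp_rw [h1]
    exact hmod

theorem Admissible.add (hM : IsSeqModular p α M) (hα : 0 < α) (hs : Continuous s)
    {f g : 𝓢'(Eucl n, ℂ)} {a b c : ℝ≥0∞} (hf : Admissible θ M s f a) (hg : Admissible θ M s g b)
    (hc : a ^ α + b ^ α ≤ c ^ α) (hc' : c ≠ ∞) : Admissible θ M s (f + g) c := by
  obtain ⟨ha, ha', h, hh, hmod⟩ := hf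
  obtain ⟨hb, hb', k, hk, kmod⟩ := hg
  have hac : a ≤ c := (ENNReal.rpow_le_rpow_iff hα).1 (le_self_add.trans hc)
  refine ⟨((pos_iff_ne_zero.2 ha).trans_le hac).ne', hc', fun j x => h j x + k j x,
    fun j => ?_, ?_⟩
  · rw [multiplier_add]; exact (hh j).add (hk j)
  · have hm := hM.add_div_le hα
      (fun j => (aestronglyMeasurable_weighted hs (fun j => (hh j).aestronglyMeasurable) j).enorm)
      (fun j => (aestronglyMeasurable_weighted hs (fun j => (hk j).aestronglyMeasurable) j).enorm)
      ha ha' hb hb' hc hmod kmod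
    refine (hM.mono _ _ fun j => Eventually.of_forall fun x => ?_).trans hm
    refine ENNReal.div_le_div_right ?_ _
    simp only [weighted, mul_add]
    exact enorm_add_le _ _

/-- Sup bounds for all representatives in terms of an admissible bound. -/
theorem exists_ae_norm_le (hM : IsSeqModular p α M) (hθ : IsDyadicResolution θ)
    {r : ℝ} (hr : 0 < r) (hr1 : r ≤ 1) (hrp : ∀ᵐ x ∂(volume : Measure (Eucl n)), r ≤ p x)
    (hs : IsLogHolder s) :
    ∃ (C : ℝ) (N : ℕ), 0 ≤ C ∧ ∀ (f : 𝓢'(Eucl n, ℂ)) (a : ℝ≥0∞) (h : ℕ → Eucl n → ℂ),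
      a ≠ 0 → a ≠ ∞ → (∀ j, Represents (h j) (multiplier (θ j) f)) →
      M (fun j x => ‖weighted s h j x‖ₑ / a) ≤ 1 →
      ∀ j, ∀ᵐ x, ‖h j x‖ ≤ a.toReal * (C * 2 ^ (j * N)) := by
  obtain ⟨S, hS⟩ := hs.exists_abs_le
  obtain ⟨C, N, hC, hb⟩ := hθ.exists_sup_bound hr hr1 hrp hS
  refine ⟨C, N, hC, fun f a h ha ha' hh hmod j => ?_⟩
  have hat : 0 < a.toReal := ENNReal.toReal_pos ha ha'
  set c : ℂ := ((a.toReal⁻¹ : ℝ) : ℂ) with hc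
  have hcn : ‖c‖ = a.toReal⁻¹ := by
    rw [hc, Complex.norm_real, Real.norm_of_nonneg (by positivity)]
  have hce : ‖c‖ₑ = a⁻¹ := by
    rw [← ofReal_norm, hcn, ENNReal.ofReal_inv_of_pos hat, ENNReal.ofReal_toReal ha']
  have h1 := hM.component _ (fun j =>
    ((aestronglyMeasurable_weighted hs.continuous
      (fun j => (hh j).aestronglyMeasurable) j).enorm).div_const a) hmod j
  have h2 : ∀ x, ‖weighted s h j x‖ₑ / a = ‖weighted s (fun j x => c * h j x) j x‖ₑ := fun x => by
    have : weighted s (fun j x => c * h j x) j x = c * weighted s h j x := by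
      simp only [weighted]; ring
    rw [this, enorm_mul, hce, mul_comm, div_eq_mul_inv]
  simp_rw [h2] at h1
  have h3 := hb j (c • f) (fun j x => c * h j x)
    (by rw [multiplier_smul]; exact (hh j).smul c) h1
  filter_upwards [h3] with x hx
  rw [norm_mul, hcn, inv_mul_le_iff₀ hat] at hx
  exact hx

theorem norm_apply_le_of_ae_le {h : Eucl n → ℂ} {T : 𝓢'(Eucl n, ℂ)} (hT : Represents h T) {K : ℝ}
    (hK : ∀ᵐ x, ‖h x‖ ≤ K) (φ : 𝓢(Eucl n, ℂ)) : ‖T φ‖ ≤ K * ∫ x, ‖φ x‖ := by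
  rw [(hT φ).2, ← integral_const_mul]
  refine norm_integral_le_of_norm_le (φ.integrable.norm.const_mul K) ?_
  filter_upwards [hK] with x hx
  rw [norm_mul, mul_comm]
  gcongr

/-- The continuous embedding into tempered distributions: `f φ` is the sum of the pairings of the
pieces `θ_j(D) f` with the neighbouring blocks of `φ`, and the rapid decay of the blocks outweighs
the exponential growth of the pieces in sup norm. -/
theorem exists_norm_apply_le (hM : IsSeqModular p α M) (hθ : IsDyadicResolution θ)
    {r : ℝ} (hr : 0 < r) (hr1 : r ≤ 1) (hrp : ∀ᵐ x ∂(volume : Measure (Eucl n)), r ≤ p x)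
    (hs : IsLogHolder s) :
    ∃ P : 𝓢(Eucl n, ℂ) → ℝ, Continuous P ∧ P 0 = 0 ∧
      ∀ (f : 𝓢'(Eucl n, ℂ)) (a : ℝ≥0∞), Admissible θ M s f a → ∀ φ, ‖f φ‖ ≤ a.toReal * P φ := by
  obtain ⟨C, N, hC, hb⟩ := exists_ae_norm_le hM hθ hr hr1 hrp hs
  obtain ⟨P, hPc, hP0, hP⟩ := hθ.exists_integral_block_le (N + 1)
  refine ⟨fun φ => 2 * (5 * (C * 2 ^ (2 * (N + 1)) * P φ)), by fun_prop, by simp [hP0],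
    fun f a hf φ => ?_⟩
  obtain ⟨ha, ha', h, hh, hmod⟩ := hf
  have hPφ : 0 ≤ P φ := le_trans (by positivity) (hP 0 φ)
  set A : ℝ := a.toReal * (5 * (C * 2 ^ (2 * (N + 1)) * P φ)) with hA
  have hA0 : 0 ≤ A := by positivity
  -- the pairing of a dyadic piece with a neighbouring block
  have hterm : ∀ j k : ℕ, j ≤ k + 2 → ‖multiplier (θ j) f (block (θ k) φ)‖ ≤
      a.toReal * (C * 2 ^ (2 * (N + 1)) * P φ) * (1 / 2) ^ j := by
    intro j k hjk
    refine (norm_apply_le_of_ae_le (hh j) (hb f a h ha ha' hh hmod j) _).trans ?_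
    have h1 : (2 : ℝ) ^ (j * N) * 2 ^ j ≤ 2 ^ (2 * (N + 1)) * 2 ^ (k * (N + 1)) := by
      rw [← pow_add, ← pow_add]
      refine pow_le_pow_right₀ one_le_two ?_
      nlinarith
    have h2 := hP k φ
    have h3 : 0 ≤ ∫ x, ‖block (θ k) φ x‖ := integral_nonneg fun x => norm_nonneg _
    have h4 : (2 : ℝ) ^ (j * N) * 2 ^ j * ∫ x, ‖block (θ k) φ x‖ ≤ 2 ^ (2 * (N + 1)) * P φ := by
      calc _ ≤ 2 ^ (2 * (N + 1)) * 2 ^ (k * (N + 1)) * ∫ x, ‖block (θ k) φ x‖ := by gcongr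
        _ = 2 ^ (2 * (N + 1)) * (2 ^ (k * (N + 1)) * ∫ x, ‖block (θ k) φ x‖) := by ring
        _ ≤ _ := by gcongr
    have h5 : (2 : ℝ) ^ j * (1 / 2) ^ j = 1 := by rw [← mul_pow]; norm_num
    calc a.toReal * (C * 2 ^ (j * N)) * ∫ x, ‖block (θ k) φ x‖
        = a.toReal * C * (2 ^ (j * N) * 2 ^ j * ∫ x, ‖block (θ k) φ x‖) * (1 / 2) ^ j := by
          linear_combination (-(a.toReal * C * 2 ^ (j * N) * ∫ x, ‖block (θ k) φ x‖)) * h5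
      _ ≤ a.toReal * C * (2 ^ (2 * (N + 1)) * P φ) * (1 / 2) ^ j := by gcongr
      _ = _ := by ring
  have hpiece : ∀ j, ‖multiplier (θ j) f φ‖ ≤ A * (1 / 2) ^ j := by
    intro j
    rw [hθ.multiplier_eq_sum]
    refine (norm_sum_le_of_le _ fun k hk =>
      hterm j k (by rw [Finset.mem_Icc] at hk; omega)).trans ?_
    rw [Finset.sum_const, nsmul_eq_mul]
    have hcard : (((Finset.Icc (j - 2) (j + 2)).card : ℕ) : ℝ) ≤ 5 := by
      rw [Nat.card_Icc]
      exact_mod_cast (by omega : j + 2 + 1 - (j - 2) ≤ 5)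
    calc _ ≤ 5 * (a.toReal * (C * 2 ^ (2 * (N + 1)) * P φ) * (1 / 2) ^ j) := by gcongr
      _ = _ := by rw [hA]; ring
  have hlim := (hθ.tendsto_sum_multiplier f φ).norm
  refine le_of_tendsto hlim (Eventually.of_forall fun J => ?_)
  calc ‖∑ j ∈ Finset.range J, multiplier (θ j) f φ‖
      ≤ ∑ j ∈ Finset.range J, A * (1 / 2) ^ j := norm_sum_le_of_le _ fun j _ => hpiece j
    _ = A * ∑ j ∈ Finset.range J, (1 / 2 : ℝ) ^ j := by rw [Finset.mul_sum]
    _ ≤ A * 2 := by gcongr; exact sum_geometric_two_le J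
    _ = _ := by rw [hA]; ring

end Gauge

/-! ### Countable sums -/

/-- A series of tempered distributions dominated termwise by a fixed continuous function on the
Schwartz space converges to a tempered distribution. -/
theorem exists_hasSum_apply {P : 𝓢(Eucl n, ℂ) → ℝ} (hP : Continuous P) (hP0 : P 0 = 0)
    {f : ℕ → 𝓢'(Eucl n, ℂ)} {c : ℕ → ℝ} (hc : Summable c)
    (h : ∀ k φ, ‖f k φ‖ ≤ c k * P φ) :
    ∃ g : 𝓢'(Eucl n, ℂ), ∀ φ, HasSum (fun k => f k φ) (g φ) := by
  have hs : ∀ φ, Summable fun k => f k φ := fun φ =>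
    Summable.of_norm_bounded (hc.mul_right (P φ)) fun k => h k φ
  have hle : ∀ φ, ‖∑' k, f k φ‖ ≤ (∑' k, c k) * P φ := fun φ =>
    tsum_of_norm_bounded (hc.hasSum.mul_right (P φ)) fun k => h k φ
  let L : 𝓢(Eucl n, ℂ) →ₗ[ℂ] ℂ :=
    { toFun := fun φ => ∑' k, f k φ
      map_add' := fun φ ψ => by
        simp_rw [map_add]; exact (hs φ).tsum_add (hs ψ)
      map_smul' := fun a φ => by
        simp_rw [map_smul, smul_eq_mul]; exact tsum_mul_left }
  have hL : Continuous L := by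
    refine continuous_of_continuousAt_zero L ?_
    rw [ContinuousAt, map_zero]
    refine squeeze_zero_norm hle ?_
    have : Tendsto (fun φ => (∑' k, c k) * P φ) (𝓝 0) (𝓝 ((∑' k, c k) * P 0)) :=
      (hP.const_mul _).tendsto 0
    rwa [hP0, mul_zero] at this
  exact ⟨ContinuousLinearMap.toPointwiseConvergenceCLM ℂ (RingHom.id ℂ) _ _ ⟨L, hL⟩,
    fun φ => (hs φ).hasSum⟩

/-- Representatives may be summed termwise under summable sup bounds. -/
theorem Represents.tsum {h : ℕ → Eucl n → ℂ} {T : ℕ → 𝓢'(Eucl n, ℂ)} {U : 𝓢'(Eucl n, ℂ)}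
    (hT : ∀ k, Represents (h k) (T k)) {K : ℕ → ℝ} (hK : Summable K)
    (hb : ∀ k, ∀ᵐ x, ‖h k x‖ ≤ K k) (hU : ∀ φ, HasSum (fun k => T k φ) (U φ)) :
    Represents (fun x => ∑' k, h k x) U := by
  have hall : ∀ᵐ x, ∀ k, ‖h k x‖ ≤ K k := ae_all_iff.2 hb
  have hmeas : AEStronglyMeasurable (fun x => ∑' k, h k x) := by
    refine aestronglyMeasurable_of_tendsto_ae atTop
      (f := fun L x => ∑ k ∈ Finset.range L, h k x)
      (fun L => Finset.aestronglyMeasurable_fun_sum _ fun k _ => (hT k).aestronglyMeasurable) ?_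
    filter_upwards [hall] with x hx
    exact (Summable.of_norm_bounded hK hx).hasSum.tendsto_sum_nat
  intro φ
  have hint : Integrable (fun x => φ x * ∑' k, h k x) := by
    refine φ.integrable.mul_bdd (c := ∑' k, K k) hmeas ?_
    filter_upwards [hall] with x hx
    exact tsum_of_norm_bounded hK.hasSum hx
  refine ⟨hint, ?_⟩
  have h1 := hasSum_integral_of_summable_integral_norm (F := fun k x => φ x * h k x)
    (fun k => (hT k φ).1) (by
      refine Summable.of_nonneg_of_le (fun k => integral_nonneg fun x => norm_nonneg _)
        (fun k => ?_) (hK.mul_right (∫ x, ‖φ x‖))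
      rw [← integral_const_mul]
      refine integral_mono_ae (hT k φ).1.norm (φ.integrable.norm.const_mul _) ?_
      filter_upwards [hb k] with x hx
      simp only [norm_mul]
      rw [mul_comm]
      gcongr)
  have h2 : (fun k => ∫ x, φ x * h k x) = fun k => T k φ := funext fun k => ((hT k φ).2).symm
  rw [h2] at h1
  simp_rw [tsum_mul_left] at h1
  exact (hU φ).unique h1

section Admissible

variable {p s : Eucl n → ℝ} {α : ℝ} {M : (ℕ → Eucl n → ℝ≥0∞) → ℝ≥0∞} {θ : ℕ → 𝓢(Eucl n, ℂ)}

/-- A series of distributions with summable admissible bounds converges, and the sum satisfies the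
countable `α`-triangle inequality. -/
theorem exists_hasSum_admissible (hM : IsSeqModular p α M) (hα : 0 < α)
    (hθ : IsDyadicResolution θ) {r : ℝ} (hr : 0 < r) (hr1 : r ≤ 1)
    (hrp : ∀ᵐ x ∂(volume : Measure (Eucl n)), r ≤ p x) (hs : IsLogHolder s)
    {f : ℕ → 𝓢'(Eucl n, ℂ)} {a : ℕ → ℝ≥0∞} (hf : ∀ k, Admissible θ M s (f k) (a k))
    (hsum : ∑' k, a k ≠ ∞) :
    ∃ g : 𝓢'(Eucl n, ℂ), (∀ φ, HasSum (fun k => f k φ) (g φ)) ∧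
      ∀ b : ℝ≥0∞, b ≠ ∞ → ∑' k, a k ^ α ≤ b ^ α → Admissible θ M s g b := by
  obtain ⟨P, hPc, hP0, hP⟩ := exists_norm_apply_le hM hθ hr hr1 hrp hs
  obtain ⟨C, N, hC, hb⟩ := exists_ae_norm_le hM hθ hr hr1 hrp hs
  have hsum' : Summable fun k => (a k).toReal := ENNReal.summable_toReal hsum
  obtain ⟨g, hg⟩ := exists_hasSum_apply hPc hP0 hsum' fun k φ => hP (f k) (a k) (hf k) φ
  choose ha ha' h hh hmod using hf
  have hbound := fun k => hb (f k) (a k) (h k) (ha k) (ha' k) (hh k) (hmod k)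
  refine ⟨g, hg, fun b hb' hab => ?_⟩
  have ha0b : a 0 ≤ b := (ENNReal.rpow_le_rpow_iff hα).1 ((ENNReal.le_tsum 0).trans hab)
  refine ⟨((pos_iff_ne_zero.2 (ha 0)).trans_le ha0b).ne', hb', fun j x => ∑' k, h k j x,
    fun j => ?_, ?_⟩
  · exact Represents.tsum (fun k => hh k j) (hsum'.mul_right _) (fun k => hbound k j)
      fun φ => hg (block (θ j) φ)
  -- the partial sums satisfy the finite triangle inequality; pass to the limit by Fatou's lemma
  have hmeas : ∀ k j, AEMeasurable fun x => ‖weighted s (h k) j x‖ₑ := fun k j =>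
    (aestronglyMeasurable_weighted hs.continuous (fun j => (hh k j).aestronglyMeasurable) j).enorm
  set F : ℕ → ℕ → Eucl n → ℝ≥0∞ := fun L j x =>
    (∑ k ∈ Finset.range (L + 1), ‖weighted s (h k) j x‖ₑ) / b with hF
  have hFm : ∀ L j, AEMeasurable (F L j) := fun L j =>
    (Finset.aemeasurable_fun_sum _ fun k _ => hmeas k j).div_const b
  have hF1 : ∀ L, M (F L) ≤ 1 := fun L =>
    hM.sum_div_le hα hmeas ha ha' hmod L ((ENNReal.sum_le_tsum _).trans hab)
  refine (hM.mono _ _ fun j => ?_).trans (hM.fatou F hFm hF1)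
  have hall : ∀ᵐ x, ∀ k, ‖h k j x‖ ≤ (a k).toReal * (C * 2 ^ (j * N)) :=
    ae_all_iff.2 fun k => hbound k j
  filter_upwards [hall] with x hx
  have hsx : Summable fun k => h k j x := Summable.of_norm_bounded (hsum'.mul_right _) hx
  have hlim : Tendsto (fun L => ‖∑ k ∈ Finset.range (L + 1), weighted s (h k) j x‖ₑ / b) atTop
      (𝓝 (‖weighted s (fun j x => ∑' k, h k j x) j x‖ₑ / b)) := by
    have h1 : Tendsto (fun L => ∑ k ∈ Finset.range L, weighted s (h k) j x) atTop
        (𝓝 (weighted s (fun j x => ∑' k, h k j x) j x)) :=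
      (hsx.hasSum.mul_left _).tendsto_sum_nat
    have h2 := (h1.comp (tendsto_add_atTop_nat 1)).enorm
    exact ENNReal.Tendsto.div_const h2
      (Or.inr ((pos_iff_ne_zero.2 (ha 0)).trans_le ha0b).ne')
  rw [← hlim.liminf_eq]
  refine liminf_le_liminf (Eventually.of_forall fun L => ?_)
  exact ENNReal.div_le_div_right (enorm_sum_le _ _) _

end Admissible

end Fourier

/-! ### Quasi-Banach spaces from gauges -/

/-- A relation `G u a`, read as "`a` is an admissible bound for `u`", with the properties that make
`u ↦ inf {a | G u a}` a complete `α`-norm. The field `sum` is the countable `α`-triangle inequality,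
stated for all tails of the series, so that no topology on `V` is needed to express its
convergence. -/
structure IsGauge {V : Type*} [AddCommGroup V] [Module ℂ V] (α : ℝ) (G : V → ℝ≥0∞ → Prop) :
    Prop where
  ne_top : ∀ u a, G u a → a ≠ ∞
  zero : ∀ a, a ≠ 0 → a ≠ ∞ → G 0 a
  smul : ∀ (c : ℂ) u a, c ≠ 0 → G u a → G (c • u) (‖c‖ₑ * a)
  add : ∀ u v a b c, G u a → G v b → a ^ α + b ^ α ≤ c ^ α → c ≠ ∞ → G (u + v) c
  sum : ∀ (u : ℕ → V) (a : ℕ → ℝ≥0∞), (∀ k, G (u k) (a k)) → ∑' k, a k ≠ ∞ →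
    ∃ w, ∀ K b, b ≠ ∞ → ∑' k, a (k + K) ^ α ≤ b ^ α → G (w - ∑ k ∈ Finset.range K, u k) b
  separation : ∀ u, (∀ ε : ℝ≥0∞, 0 < ε → ∃ a < ε, G u a) → u = 0

/-- The infimum of the admissible bounds. -/
def gaugeNorm {V : Type*} (G : V → ℝ≥0∞ → Prop) (u : V) : ℝ≥0∞ := sInf {a | G u a}

theorem exists_seq_tendsto_gaugeNorm {V : Type*} {G : V → ℝ≥0∞ → Prop} {u : V} (hu : ∃ a, G u a) :
    ∃ a : ℕ → ℝ≥0∞, (∀ k, G u (a k)) ∧ Tendsto a atTop (𝓝 (gaugeNorm G u)) := by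
  obtain ⟨a, -, ha, hmem⟩ := exists_seq_tendsto_sInf (S := {a | G u a}) hu (OrderBot.bddBelow _)
  exact ⟨a, hmem, ha⟩

namespace IsGauge

variable {V : Type*} [AddCommGroup V] [Module ℂ V] {α : ℝ} {G : V → ℝ≥0∞ → Prop}

theorem norm_zero (hG : IsGauge α G) : gaugeNorm G 0 = 0 := by
  refine le_antisymm (le_of_forall_gt fun c hc => ?_) bot_le
  obtain ⟨d, hd, hdc⟩ := exists_between hc
  exact lt_of_le_of_lt (sInf_le (hG.zero d hd.ne' hdc.ne_top)) hdc

theorem norm_smul_le (hG : IsGauge α G) {c : ℂ} (hc : c ≠ 0) {u : V} (hu : ∃ a, G u a) :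
    gaugeNorm G (c • u) ≤ ‖c‖ₑ * gaugeNorm G u := by
  obtain ⟨a, ha, hlim⟩ := exists_seq_tendsto_gaugeNorm hu
  refine ge_of_tendsto' (ENNReal.Tendsto.const_mul hlim (Or.inr enorm_ne_top)) fun k => ?_
  exact sInf_le (hG.smul c u _ hc (ha k))

theorem norm_smul (hG : IsGauge α G) (c : ℂ) {u : V} (hu : ∃ a, G u a) :
    gaugeNorm G (c • u) = ‖c‖ₑ * gaugeNorm G u := by
  rcases eq_or_ne c 0 with rfl | hc
  · simp [hG.norm_zero]
  refine le_antisymm (hG.norm_smul_le hc hu) ?_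
  obtain ⟨a, ha⟩ := hu
  have h := hG.norm_smul_le (inv_ne_zero hc) ⟨_, hG.smul c u a hc ha⟩
  rw [smul_smul, inv_mul_cancel₀ hc, one_smul] at h
  have h0 : ‖c‖ₑ ≠ 0 := by simpa using hc
  calc ‖c‖ₑ * gaugeNorm G u ≤ ‖c‖ₑ * (‖c⁻¹‖ₑ * gaugeNorm G (c • u)) := by gcongr
    _ = _ := by
      rw [enorm_inv hc, ← mul_assoc, ENNReal.mul_inv_cancel h0 enorm_ne_top, one_mul]

/-- The `α`-triangle inequality. -/
theorem norm_add_rpow_le (hG : IsGauge α G) (hα : 0 < α) {u v : V} (hu : ∃ a, G u a)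
    (hv : ∃ a, G v a) :
    gaugeNorm G (u + v) ^ α ≤ gaugeNorm G u ^ α + gaugeNorm G v ^ α := by
  obtain ⟨a, ha, hla⟩ := exists_seq_tendsto_gaugeNorm hu
  obtain ⟨b, hb, hlb⟩ := exists_seq_tendsto_gaugeNorm hv
  refine ge_of_tendsto' ((hla.ennrpow_const α).add (hlb.ennrpow_const α)) fun k => ?_
  have hc : ((a k ^ α + b k ^ α) ^ (1 / α)) ^ α = a k ^ α + b k ^ α := by
    rw [← ENNReal.rpow_mul, one_div_mul_cancel hα.ne', ENNReal.rpow_one]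
  rw [← hc]
  refine ENNReal.rpow_le_rpow (sInf_le (hG.add u v _ _ _ (ha k) (hb k) hc.ge ?_)) hα.le
  refine ENNReal.rpow_ne_top_of_nonneg (by positivity) (ENNReal.add_ne_top.2 ⟨?_, ?_⟩)
  · exact ENNReal.rpow_ne_top_of_nonneg hα.le (hG.ne_top _ _ (ha k))
  · exact ENNReal.rpow_ne_top_of_nonneg hα.le (hG.ne_top _ _ (hb k))

theorem exists_add (hG : IsGauge α G) (hα : 0 < α) {u v : V} (hu : ∃ a, G u a)
    (hv : ∃ a, G v a) : ∃ a, G (u + v) a := by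
  obtain ⟨a, ha⟩ := hu
  obtain ⟨b, hb⟩ := hv
  refine ⟨(a ^ α + b ^ α) ^ (1 / α), hG.add u v a b _ ha hb ?_ ?_⟩
  · rw [← ENNReal.rpow_mul, one_div_mul_cancel hα.ne', ENNReal.rpow_one]
  · refine ENNReal.rpow_ne_top_of_nonneg (by positivity) (ENNReal.add_ne_top.2 ⟨?_, ?_⟩)
    · exact ENNReal.rpow_ne_top_of_nonneg hα.le (hG.ne_top _ _ ha)
    · exact ENNReal.rpow_ne_top_of_nonneg hα.le (hG.ne_top _ _ hb)

theorem exists_smul (hG : IsGauge α G) (c : ℂ) {u : V} (hu : ∃ a, G u a) :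
    ∃ a, G (c • u) a := by
  obtain ⟨a, ha⟩ := hu
  rcases eq_or_ne c 0 with rfl | hc
  · exact ⟨1, by rw [zero_smul]; exact hG.zero 1 one_ne_zero ENNReal.one_ne_top⟩
  · exact ⟨_, hG.smul c u a hc ha⟩

theorem exists_sub (hG : IsGauge α G) (hα : 0 < α) {u v : V} (hu : ∃ a, G u a)
    (hv : ∃ a, G v a) : ∃ a, G (u - v) a := by
  have h := hG.exists_add hα hu (hG.exists_smul (-1) hv)
  rwa [neg_one_smul, ← sub_eq_add_neg] at h

theorem tsum_two_inv_pow_add (K : ℕ) : ∑' k, (2⁻¹ : ℝ≥0∞) ^ (k + K) = 2 * 2⁻¹ ^ K := by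
  simp_rw [pow_add]
  rw [ENNReal.tsum_mul_right, ENNReal.tsum_geometric, ENNReal.one_sub_inv_two, inv_inv]

/-- Completeness: a rapidly converging subsequence is summed up as a telescoping series. -/
theorem complete (hG : IsGauge α G) (hα : 0 < α) (hα1 : α ≤ 1) (u : ℕ → V)
    (hu : ∀ k, ∃ a, G (u k) a)
    (hcau : ∀ ε : ℝ≥0∞, 0 < ε → ∃ k₀ : ℕ, ∀ k ≥ k₀, ∀ l ≥ k₀, gaugeNorm G (u k - u l) < ε) :
    ∃ f, (∃ a, G f a) ∧ Tendsto (fun k => gaugeNorm G (u k - f)) atTop (𝓝 0) := by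
  set d : ℕ → ℝ≥0∞ := fun k => ((2⁻¹ : ℝ≥0∞) ^ k) ^ (1 / α) with hd
  have hdα : ∀ k, d k ^ α = 2⁻¹ ^ k := fun k => by
    rw [hd, ← ENNReal.rpow_mul, one_div_mul_cancel hα.ne', ENNReal.rpow_one]
  have h2pos : ∀ k : ℕ, (0 : ℝ≥0∞) < 2⁻¹ ^ k := fun k => ENNReal.pow_pos (by simp) k
  have h2top : ∀ k : ℕ, (2⁻¹ : ℝ≥0∞) ^ k ≠ ∞ := fun k => ENNReal.pow_ne_top (by simp)
  have hd0 : ∀ k, 0 < d k := fun k => ENNReal.rpow_pos (h2pos k) (h2top k)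
  have hdle : ∀ k, d k ≤ 2⁻¹ ^ k := fun k => by
    refine ENNReal.rpow_le_self_of_le_one (pow_le_one₀ bot_le (by simp)) ?_
    rw [le_div_iff₀ hα]; linarith
  obtain ⟨ν, -, hν⟩ := extraction_forall_of_eventually
    (P := fun k m => ∀ i ≥ m, ∀ l ≥ m, gaugeNorm G (u i - u l) < d k) fun k => by
      obtain ⟨k₀, hk₀⟩ := hcau (d k) (hd0 k)
      filter_upwards [eventually_ge_atTop k₀] with m hm i hi l hl
      exact hk₀ i (hm.trans hi) l (hm.trans hl)
  -- the partial sums of `ν` dominate `ν` and are increasing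
  set μ : ℕ → ℕ := fun K => ∑ i ∈ Finset.range (K + 1), ν i with hμ
  have hμν : ∀ K, ν K ≤ μ K := fun K =>
    Finset.single_le_sum (fun _ _ => Nat.zero_le _) (Finset.mem_range.2 (Nat.lt_succ_self K))
  have hμmono : ∀ K, μ K ≤ μ (K + 1) := fun K => by
    simp only [hμ]
    rw [Finset.sum_range_succ _ (K + 1)]
    exact Nat.le_add_right _ _
  have hv : ∀ k, ∃ a < d k, G (u (μ (k + 1)) - u (μ k)) a := fun k => by
    have := hν k (μ (k + 1)) ((hμν k).trans (hμmono k)) (μ k) (hμν k)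
    obtain ⟨a, ha, had⟩ := sInf_lt_iff.1 this
    exact ⟨a, had, ha⟩
  choose a had ha using hv
  have hatop : ∑' k, a k ≠ ∞ := by
    refine ne_top_of_le_ne_top ?_
      (ENNReal.tsum_le_tsum fun k => ((had k).le.trans (hdle k)))
    have := tsum_two_inv_pow_add 0
    simp only [add_zero, pow_zero, mul_one] at this
    rw [this]; simp
  obtain ⟨w, hw⟩ := hG.sum _ a ha hatop
  have htel : ∀ K, ∑ k ∈ Finset.range K, (u (μ (k + 1)) - u (μ k)) = u (μ K) - u (μ 0) :=
    fun K => Finset.sum_range_sub (fun k => u (μ k)) K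
  set b : ℕ → ℝ≥0∞ := fun K => (2 * (2⁻¹ : ℝ≥0∞) ^ K) ^ (1 / α) with hb
  have hbα : ∀ K, b K ^ α = 2 * 2⁻¹ ^ K := fun K => by
    rw [hb, ← ENNReal.rpow_mul, one_div_mul_cancel hα.ne', ENNReal.rpow_one]
  have hbtop : ∀ K, b K ≠ ∞ := fun K => ENNReal.rpow_ne_top_of_nonneg (by positivity)
    (ENNReal.mul_ne_top (by simp) (h2top K))
  have hwK : ∀ K, G (w + u (μ 0) - u (μ K)) (b K) := fun K => by
    have := hw K (b K) (hbtop K) ?_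
    · rw [htel] at this
      convert this using 1
      abel
    · rw [hbα, ← tsum_two_inv_pow_add]
      refine ENNReal.tsum_le_tsum fun k => ?_
      rw [← hdα]
      exact ENNReal.rpow_le_rpow (had _).le hα.le
  have hfS : ∃ a, G (w + u (μ 0)) a := by
    have := hG.exists_add hα ⟨_, hwK 0⟩ (hu (μ 0))
    rwa [sub_add_cancel] at this
  refine ⟨w + u (μ 0), hfS, ?_⟩
  have hest : ∀ K, ∀ k ≥ μ K, gaugeNorm G (u k - (w + u (μ 0))) ^ α ≤ 3 * 2⁻¹ ^ K := by
    intro K k hk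
    have h1 : gaugeNorm G (u k - u (μ K)) < d K :=
      hν K k ((hμν K).trans hk) (μ K) (hμν K)
    have h2 : gaugeNorm G (u (μ K) - (w + u (μ 0))) ≤ b K := by
      have h3 := hG.norm_smul (-1) ⟨_, hwK K⟩
      rw [neg_one_smul, neg_sub, enorm_neg, enorm_one, one_mul] at h3
      rw [h3]
      exact sInf_le (hwK K)
    have h4 := hG.norm_add_rpow_le hα (hG.exists_sub hα (hu k) (hu (μ K)))
      (hG.exists_sub hα (hu (μ K)) hfS)
    rw [sub_add_sub_cancel] at h4
    calc _ ≤ d K ^ α + b K ^ α := h4.trans (add_le_add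
          (ENNReal.rpow_le_rpow h1.le hα.le) (ENNReal.rpow_le_rpow h2 hα.le))
      _ = _ := by rw [hdα, hbα]; ring
  rw [ENNReal.tendsto_atTop_zero]
  intro ε hε
  have hlim : Tendsto (fun K : ℕ => 3 * (2⁻¹ : ℝ≥0∞) ^ K) atTop (𝓝 0) := by
    have h := ENNReal.tendsto_pow_atTop_nhds_zero_of_lt_one
      (r := 2⁻¹) (ENNReal.inv_lt_one.2 ENNReal.one_lt_two)
    simpa using ENNReal.Tendsto.const_mul h (a := 3) (Or.inr (by simp))
  have hεα : 0 < ε ^ α := by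
    rcases eq_or_ne ε ∞ with rfl | h
    · rw [ENNReal.top_rpow_of_pos hα]; simp
    · exact ENNReal.rpow_pos hε h
  obtain ⟨K, hK⟩ := (hlim.eventually_lt_const hεα).exists
  refine ⟨μ K, fun k hk => ?_⟩
  rw [← ENNReal.rpow_le_rpow_iff hα]
  exact (hest K k hk).trans hK.le

/-- An `α`-norm is a quasi-norm with the constant `2 ^ (1 / α)`. -/
theorem isQuasiBanach (hG : IsGauge α G) (hα : 0 < α) (hα1 : α ≤ 1) :
    IsQuasiBanach {u | ∃ a, G u a} (gaugeNorm G) where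
  zero_mem := ⟨1, hG.zero 1 one_ne_zero ENNReal.one_ne_top⟩
  add_mem := fun f hf g hg => hG.exists_add hα hf hg
  smul_mem := fun c f hf => hG.exists_smul c hf
  finite := fun f ⟨a, ha⟩ => (sInf_le ha).trans_lt (hG.ne_top _ _ ha).lt_top
  eq_zero_iff := fun f _ => by
    refine ⟨fun h => hG.separation f fun ε hε => ?_, fun h => h ▸ hG.norm_zero⟩
    rw [← h] at hε
    obtain ⟨a, ha, haε⟩ := sInf_lt_iff.1 hε
    exact ⟨a, haε, ha⟩
  smul := fun c f hf => hG.norm_smul c hf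
  quasi_triangle := by
    refine ⟨2 ^ (1 / α), ENNReal.one_le_rpow one_le_two (by positivity),
      ENNReal.rpow_ne_top_of_nonneg (by positivity) (by simp), fun f hf g hg => ?_⟩
    rw [← ENNReal.rpow_le_rpow_iff hα, ENNReal.mul_rpow_of_nonneg _ _ hα.le, ← ENNReal.rpow_mul,
      one_div_mul_cancel hα.ne', ENNReal.rpow_one, two_mul]
    refine (hG.norm_add_rpow_le hα hf hg).trans (add_le_add ?_ ?_)
    · exact ENNReal.rpow_le_rpow le_self_add hα.le
    · exact ENNReal.rpow_le_rpow le_add_self hα.le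
  complete := fun u hu hcau => hG.complete hα hα1 u hu hcau

end IsGauge

/-! ### Restriction to an open set -/

section Restrict

variable {n : ℕ} {Ω : TopologicalSpace.Opens (Eucl n)}

theorem restrict_add (g h : 𝓢'(Eucl n, ℂ)) :
    restrict Ω (g + h) = restrict Ω g + restrict Ω h := by
  ext φ; rfl

theorem restrict_smul (c : ℂ) (g : 𝓢'(Eucl n, ℂ)) :
    restrict Ω (c • g) = c • restrict Ω g := by
  ext φ; rfl

/-- Restriction as a linear map. -/
def restrictLM (Ω : TopologicalSpace.Opens (Eucl n)) : 𝓢'(Eucl n, ℂ) →ₗ[ℂ] 𝓓'(Ω, ℂ) where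
  toFun := restrict Ω
  map_add' := restrict_add
  map_smul' := restrict_smul

/-- `a` is an admissible bound for some extension of `f`. -/
def RestrictAdmissible (Ω : TopologicalSpace.Opens (Eucl n)) (θ : ℕ → 𝓢(Eucl n, ℂ))
    (M : (ℕ → Eucl n → ℝ≥0∞) → ℝ≥0∞) (s : Eucl n → ℝ) (f : 𝓓'(Ω, ℂ)) (a : ℝ≥0∞) : Prop :=
  ∃ g : 𝓢'(Eucl n, ℂ), Admissible θ M s g a ∧ f = restrict Ω g

variable {p s : Eucl n → ℝ} {α : ℝ} {M : (ℕ → Eucl n → ℝ≥0∞) → ℝ≥0∞} {θ : ℕ → 𝓢(Eucl n, ℂ)}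

/-- Sums are formed on the whole space and restricted afterwards. Separation comes from the
embedding into tempered distributions: extensions of `f` with arbitrarily small norm force
`f = 0`. -/
theorem isGauge_restrictAdmissible (hM : IsSeqModular p α M) (hα : 0 < α)
    (hθ : IsDyadicResolution θ) {r : ℝ} (hr : 0 < r) (hr1 : r ≤ 1)
    (hrp : ∀ᵐ x ∂(volume : Measure (Eucl n)), r ≤ p x) (hs : IsLogHolder s) :
    IsGauge α (RestrictAdmissible Ω θ M s) where
  ne_top := fun u a ⟨g, hg, _⟩ => hg.2.1
  zero := fun a ha ha' => ⟨0, Admissible.zero hM ha ha', (map_zero (restrictLM Ω)).symm⟩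
  smul := by
    rintro c u a hc ⟨g, hg, rfl⟩
    exact ⟨c • g, hg.smul hc, (restrict_smul c g).symm⟩
  add := by
    rintro u v a b c ⟨g, hg, rfl⟩ ⟨h, hh, rfl⟩ hc hc'
    exact ⟨g + h, hg.add hM hα hs.continuous hh hc hc', (restrict_add g h).symm⟩
  sum := by
    intro u a hua hsum
    choose g hg hu using hua
    obtain ⟨G, hG, -⟩ := exists_hasSum_admissible hM hα hθ hr hr1 hrp hs hg hsum
    refine ⟨restrict Ω G, fun K b hb hab => ?_⟩
    obtain ⟨G', hG', hadm⟩ := exists_hasSum_admissible hM hα hθ hr hr1 hrp hs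
      (f := fun k => g (k + K)) (fun k => hg (k + K))
      (ne_top_of_le_ne_top hsum (ENNReal.tsum_comp_le_tsum_of_injective
        (add_left_injective K) a))
    refine ⟨G', hadm b hb hab, ?_⟩
    have h1 : G' = G - ∑ k ∈ Finset.range K, g k := by
      ext φ
      refine (hG' φ).unique ?_
      rw [sub_apply, sum_apply]
      exact (hasSum_nat_add_iff' K).2 (hG φ)
    rw [h1]
    refine Eq.trans ?_ (map_sub (restrictLM Ω) G (∑ k ∈ Finset.range K, g k)).symm
    rw [map_sum]
    simp only [hu]
    rfl
  separation := by
    intro f hf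
    obtain ⟨P, -, -, hP⟩ := exists_norm_apply_le hM hθ hr hr1 hrp hs
    ext φ
    change f φ = 0
    rw [← norm_le_zero_iff]
    set c := P (testToSchwartzCLM Ω φ) with hc
    have hb : ∀ k : ℕ, ‖f φ‖ ≤ (1 / 2) ^ k * |c| := by
      intro k
      obtain ⟨a, ha, g, hg, rfl⟩ := hf (ENNReal.ofReal ((1 / 2) ^ k))
        (ENNReal.ofReal_pos.2 (by positivity))
      have hak : a.toReal ≤ (1 / 2) ^ k :=
        ENNReal.toReal_le_of_le_ofReal (by positivity) ha.le
      refine (hP g a hg _).trans ?_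
      calc a.toReal * c ≤ a.toReal * |c| := by gcongr; exact le_abs_self c
        _ ≤ _ := by gcongr
    have hlim : Tendsto (fun k : ℕ => (1 / 2 : ℝ) ^ k * |c|) atTop (𝓝 (0 * |c|)) :=
      (tendsto_pow_atTop_nhds_zero_of_lt_one (by norm_num) (by norm_num)).mul_const _
    rw [zero_mul] at hlim
    exact ge_of_tendsto' hlim hb

/-- The infimum over all representatives and the infimum in the Minkowski gauge may be merged. -/
theorem iInf_represents_eq (f : 𝓢'(Eucl n, ℂ)) :
    (⨅ (h : ℕ → Eucl n → ℂ) (_ : ∀ j, Represents (h j) (multiplier (θ j) f)),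
      sInf {μ : ℝ≥0∞ | 0 < μ ∧ μ ≠ ∞ ∧ M (fun j x => ‖weighted s h j x‖ₑ / μ) ≤ 1}) =
      gaugeNorm (Admissible θ M s) f := by
  refine le_antisymm (le_sInf ?_) (le_iInf₂ fun h hh => le_sInf ?_)
  · rintro a ⟨ha, ha', h, hh, hmod⟩
    exact iInf₂_le_of_le h hh (sInf_le ⟨pos_iff_ne_zero.2 ha, ha', hmod⟩)
  · rintro μ ⟨hμ, hμ', hmod⟩
    exact sInf_le ⟨hμ.ne', hμ', h, hh, hmod⟩

theorem gaugeNorm_admissible_lt_top_iff (f : 𝓢'(Eucl n, ℂ)) :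
    gaugeNorm (Admissible θ M s) f < ∞ ↔ ∃ a, Admissible θ M s f a := by
  rw [gaugeNorm, sInf_lt_iff]
  exact ⟨fun ⟨a, ha, _⟩ => ⟨a, ha⟩, fun ⟨a, ha⟩ => ⟨a, ha, ha.2.1.lt_top⟩⟩

theorem restrictedSpace_eq {N : 𝓢'(Eucl n, ℂ) → ℝ≥0∞} (hN : N = gaugeNorm (Admissible θ M s)) :
    restrictedSpace Ω {f | N f < ∞} = {f | ∃ a, RestrictAdmissible Ω θ M s f a} := by
  ext f
  simp only [restrictedSpace, hN, gaugeNorm_admissible_lt_top_iff, mem_ofPred_eq,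
    RestrictAdmissible]
  exact ⟨fun ⟨g, ⟨a, ha⟩, h⟩ => ⟨a, g, ha, h⟩, fun ⟨a, g, ha, h⟩ => ⟨g, ⟨a, ha⟩, h⟩⟩

/-- The quotient norm of the restrictions is the gauge of the admissible bounds of extensions. -/
theorem restrictedNorm_eq {N : 𝓢'(Eucl n, ℂ) → ℝ≥0∞} (hN : N = gaugeNorm (Admissible θ M s)) :
    restrictedNorm Ω {f | N f < ∞} N = gaugeNorm (RestrictAdmissible Ω θ M s) := by
  subst hN
  ext f
  refine le_antisymm (le_sInf ?_) (le_iInf₂ fun g hg => le_sInf fun a ha => ?_)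
  · rintro a ⟨g, hg, hfg⟩
    exact iInf₂_le_of_le g ⟨(gaugeNorm_admissible_lt_top_iff g).2 ⟨a, hg⟩, hfg⟩ (sInf_le hg)
  · exact sInf_le ⟨g, ha, hg.2⟩

end Restrict

/-! ### Essential infima of exponents -/

/-- The real-valued `essInf` has its intended meaning only for essentially bounded functions, whence
the upper bound among the hypotheses. -/
theorem lowerExp_pos_and_ae_le {n : ℕ} {p : Eucl n → ℝ} {a b : ℝ} (ha : 0 < a)
    (hap : ∀ᵐ x ∂(volume : Measure (Eucl n)), a ≤ p x)
    (hpb : ∀ᵐ x ∂(volume : Measure (Eucl n)), p x ≤ b) :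
    0 < lowerExp p ∧ ∀ᵐ x ∂(volume : Measure (Eucl n)), lowerExp p ≤ p x := by
  have h1 : IsBoundedUnder (· ≥ ·) (ae (volume : Measure (Eucl n))) p := ⟨a, hap⟩
  have h2 : IsBoundedUnder (· ≤ ·) (ae (volume : Measure (Eucl n))) p := ⟨b, hpb⟩
  exact ⟨ha.trans_le (le_essInf_of_ae_le a hap h2.isCoboundedUnder_ge), ae_essInf_le h1⟩

theorem IsExponent.lowerExp_pos_and_ae_le {n : ℕ} {p : Eucl n → ℝ} (hp : IsExponent p) :
    0 < lowerExp p ∧ ∀ᵐ x ∂(volume : Measure (Eucl n)), lowerExp p ≤ p x := by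
  obtain ⟨a, ha, hap⟩ := hp.essInf_pos
  obtain ⟨b, hpb⟩ := hp.essSup_lt_top
  exact VarExp.lowerExp_pos_and_ae_le ha hap hpb

theorem IsExponent.lowerExp_div_pos_and_ae_le {n : ℕ} {p q : Eucl n → ℝ} (hp : IsExponent p)
    (hq : IsExponent q) : 0 < lowerExp (fun x => p x / q x) ∧
      ∀ᵐ x ∂(volume : Measure (Eucl n)), lowerExp (fun x => p x / q x) ≤ p x / q x := by
  obtain ⟨a, ha, hap⟩ := hp.essInf_pos
  obtain ⟨b, hpb⟩ := hp.essSup_lt_top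
  obtain ⟨c, hc, hcq⟩ := hq.essInf_pos
  obtain ⟨d, hqd⟩ := hq.essSup_lt_top
  have hd : 0 < max d 1 := lt_max_of_lt_right one_pos
  refine VarExp.lowerExp_pos_and_ae_le (a := a / max d 1) (b := b / c) (div_pos ha hd) ?_ ?_
  · filter_upwards [hap, hqd] with x hx hx'
    exact div_le_div₀ (hp.pos x).le hx (hq.pos x) (hx'.trans (le_max_left _ _))
  · filter_upwards [hpb, hcq] with x hx hx'
    exact div_le_div₀ ((hp.pos x).le.trans hx) hx hc hx'

end VarExp

end

theorem mainTheorem12 (n : ℕ) (p q s : VarExp.Eucl (n + 1) → ℝ)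
    (hp : VarExp.IsExponent p) (hp' : VarExp.IsLogHolder p)
    (hq : VarExp.IsExponent q) (hq' : VarExp.IsLogHolder q)
    (hs : VarExp.IsLogHolder s)
    (θ : ℕ → 𝓢(VarExp.Eucl (n + 1), ℂ)) (hθ : VarExp.IsDyadicResolution θ) :
    (VarExp.IsQuasiBanach (VarExp.besovHalfSpace θ p q s) (VarExp.besovHalfNorm θ p q s) ∧
      VarExp.IsQuasiBanach (VarExp.triebelHalfSpace θ p q s) (VarExp.triebelHalfNorm θ p q s)) ∧
    (∀ f ∈ VarExp.triebelHalfSpace θ p q s, ∀ g ∈ VarExp.triebelHalfSpace θ p q s,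
      VarExp.triebelHalfNorm θ p q s (f + g) ^
          min (min (VarExp.lowerExp p) (VarExp.lowerExp q)) 1 ≤
        VarExp.triebelHalfNorm θ p q s f ^
            min (min (VarExp.lowerExp p) (VarExp.lowerExp q)) 1 +
          VarExp.triebelHalfNorm θ p q s g ^
            min (min (VarExp.lowerExp p) (VarExp.lowerExp q)) 1) ∧
    (∀ α : ℝ, α = min (VarExp.lowerExp q) 1 * min 1 (VarExp.lowerExp fun x => p x / q x) →
      ∀ f ∈ VarExp.besovHalfSpace θ p q s, ∀ g ∈ VarExp.besovHalfSpace θ p q s,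
        VarExp.besovHalfNorm θ p q s (f + g) ^ α ≤
          VarExp.besovHalfNorm θ p q s f ^ α + VarExp.besovHalfNorm θ p q s g ^ α) := by
  obtain ⟨hp0, hpae⟩ := hp.lowerExp_pos_and_ae_le
  obtain ⟨hq0, hqae⟩ := hq.lowerExp_pos_and_ae_le
  obtain ⟨hpq0, hpqae⟩ := hp.lowerExp_div_pos_and_ae_le hq
  have hr0 : 0 < min (VarExp.lowerExp p) 1 := lt_min hp0 one_pos
  have hrp : ∀ᵐ x, min (VarExp.lowerExp p) 1 ≤ p x := by
    filter_upwards [hpae] with x hx using (min_le_left _ _).trans hx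
  -- the gauge of the Triebel–Lizorkin space
  set r := min (min (VarExp.lowerExp p) (VarExp.lowerExp q)) 1 with hr
  have hrpos : 0 < r := lt_min (lt_min hp0 hq0) one_pos
  have hr1 : r ≤ 1 := min_le_right _ _
  have hMF : VarExp.IsSeqModular p r (VarExp.modularLpLq p q) :=
    VarExp.isSeqModular_modularLpLq hp.measurable hq.measurable hp.pos hq.pos hrpos hr1
      (by filter_upwards [hpae] with x hx
          exact ((min_le_left _ _).trans (min_le_left _ _)).trans hx)
      (by filter_upwards [hqae] with x hx
          exact ((min_le_left _ _).trans (min_le_right _ _)).trans hx)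
  have hGF := VarExp.isGauge_restrictAdmissible (Ω := VarExp.upperHalf n) hMF hrpos hθ hr0
    (min_le_right _ _) hrp hs
  have hNF : VarExp.triebelNorm θ p q s =
      VarExp.gaugeNorm (VarExp.Admissible θ (VarExp.modularLpLq p q) s) := by
    funext f
    rw [← VarExp.iInf_represents_eq]
    simp only [VarExp.triebelNorm, VarExp.normLpLq_eq hq.pos]
  have hSF : VarExp.triebelHalfSpace θ p q s = _ := VarExp.restrictedSpace_eq hNF
  have hHF : VarExp.triebelHalfNorm θ p q s = _ := VarExp.restrictedNorm_eq hNF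
  -- the gauge of the Besov space
  set t := min (VarExp.lowerExp q) 1 with ht
  set τ := min 1 (VarExp.lowerExp fun x => p x / q x) with hτ
  have htpos : 0 < t := lt_min hq0 one_pos
  have hτpos : 0 < τ := lt_min one_pos hpq0
  have ht1 : t ≤ 1 := min_le_right _ _
  have hτ1 : τ ≤ 1 := min_le_left _ _
  have hMB : VarExp.IsSeqModular p (t * τ) (VarExp.modularLqLp p q) :=
    VarExp.isSeqModular_modularLqLp hp.measurable hq.measurable hp.pos hq.pos htpos ht1 hτpos hτ1
      (by filter_upwards [hqae] with x hx using (min_le_left _ _).trans hx)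
      (by filter_upwards [hpqae] with x hx using (min_le_right _ _).trans hx)
  have htτ : 0 < t * τ := mul_pos htpos hτpos
  have hGB := VarExp.isGauge_restrictAdmissible (Ω := VarExp.upperHalf n) hMB htτ hθ hr0
    (min_le_right _ _) hrp hs
  have hNB : VarExp.besovNorm θ p q s =
      VarExp.gaugeNorm (VarExp.Admissible θ (VarExp.modularLqLp p q) s) := by
    funext f
    rw [← VarExp.iInf_represents_eq]
    rfl
  have hSB : VarExp.besovHalfSpace θ p q s = _ := VarExp.restrictedSpace_eq hNB
  have hHB : VarExp.besovHalfNorm θ p q s = _ := VarExp.restrictedNorm_eq hNB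
  rw [hSF, hHF, hSB, hHB]
  refine ⟨⟨hGB.isQuasiBanach htτ (mul_le_one₀ ht1 hτpos.le hτ1), hGF.isQuasiBanach hrpos hr1⟩,
    fun f hf g hg => hGF.norm_add_rpow_le hrpos hf hg, ?_⟩
  rintro α rfl f hf g hg
  exact hGB.norm_add_rpow_le htτ hf hg
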